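/- Let $p$ be a prime, $n\ge 1$ an integer, $|\cdot|_p$ the $p$-adic absolute value on $\mathbb{Q}_p$, $d^nx$ the Haar measure of $\mathbb{Q}_p^n$ normalized so that $\mathbb{Z}_p^n$ has measure $1$, $x\cdot y=\sum_i x_iy_i$, and $\Psi:\mathbb{Q}_p\to\mathbb{Q}_p/\mathbb{Z}_p\hookrightarrow\mathbb{Q}/\mathbb{Z}\to\mathbb{C}^{\times}$, $b\mapsto e^{2\pi i b}$, the standard additive character. Let $S$ be the space of Schwartz--Bruhat functions on $\mathbb{Q}_p^n$ (locally constant with compact support), let $(\mathcal{F}\phi)(\xi)=\int\Psi(-x\cdot\xi)\phi(x)\,d^nx$, and denote by $\mathcal{F}$ also the extension of the Fourier transform by continuity to $L^2(\mathbb{Q}_p^n)$. Let $f\in\mathbb{Q}_p[\xi_1,\dots,\xi_n]$ be an elliptic polynomial of degree $d$, i.e. $f$ is non-constant, $f(\lambda\xi)=\lambda^{d}f(\xi)$ for all $\lambda\in\mathbb{Q}_p^{\times}$, and $f(\xi)=0$ if and only if $\xi=0$. Let $\alpha>0$ and let $f(D,\alpha)v=\mathcal{F}^{-1}(|f|_p^{\alpha}\,\mathcal{F}v)$,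 with domain the set of $v\in L^2$ such that $|f|_p^{\alpha}\mathcal{F}v\in L^2$. Put $$\Xi(\xi)=\sum_{i=1}^n|\xi_i|_p^{d},\qquad \|\phi\|_\beta^2=\int\Xi(\xi)^{2\beta}|\mathcal{F}\phi(\xi)|^2\,d^n\xi,\qquad \Phi=\{\phi\in S:\ \mathcal{F}\phi(0)=0\},$$ and let $\widetilde{H}_\infty$ be the completion of $\Phi$ with respect to the family of norms $\|\cdot\|_\beta$, $\beta=0,1,2,\dots$; since $\|\cdot\|_0$ is the $L^2$ norm, $\widetilde{H}_\infty$ is regarded as a space of $L^2$ functions: the $L^2$ limits of the sequences in $\Phi$ that are Cauchy in every norm $\|\cdot\|_\beta$. Let $\varphi\in L^2(\mathbb{Q}_p^n)$ be continuous and bounded, and let $Z(x,t)=\int\Psi(x\cdot\xi)e^{-t|f(\xi)|_p^{\alpha}}\,d^n\xi$ for $t>0$. Then the function $$u(x,t)=\int Z(\eta,t)\,\varphi(x-\eta)\,d^n\eta\quad(t>0),\qquad u(x,0)=\varphi(x),$$ is well defined (the integrals defining $Z(x,t)$ and $u(x,t)$ converge absolutely) and is a classical solution of the Cauchy problem $$\frac{\partial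 u}{\partial t}(x,t)+(f(D,\alpha)u)(x,t)=0\quad(x\in\mathbb{Q}_p^n,\ t>0),\qquad u(x,0)=\varphi(x).$$ That is: $u$ is continuous on $\mathbb{Q}_p^n\times[0,\infty)$ with $u(\cdot,0)=\varphi$; for every $t>0$ the function $u(\cdot,t)$ lies in the domain of $f(D,\alpha)$; $f(D,\alpha)u(\cdot,t)$ has a representative that is continuous in $(x,t)\in\mathbb{Q}_p^n\times(0,\infty)$; and with this representative the equation holds at every point $(x,t)$ with $t>0$, $\partial u/\partial t$ existing there. Moreover $u(\cdot,t)\in\widetilde{H}_\infty$ for every fixed $t>0$. -/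

import Mathlib

open MeasureTheory Filter Topology

namespace PadicPDE

noncomputable section

/-! ### The additive character and the Haar measure -/

theorem exists_fractionalPart {p : ℕ} [Fact p.Prime] (x : ℚ_[p]) :
    ∃ q : ℚ, (∃ a k : ℕ, q = (a : ℚ) / (p : ℚ) ^ k) ∧ ‖x - (q : ℚ_[p])‖ ≤ 1 := by
  have hp1 : (1 : ℝ) < p := by exact_mod_cast (Fact.out : p.Prime).one_lt
  have hp0 : (p : ℚ_[p]) ≠ 0 := by exact_mod_cast (Fact.out : p.Prime).ne_zero
  obtain ⟨k, hk⟩ := pow_unbounded_of_one_lt ‖x‖ hp1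
  have hpk : (0 : ℝ) < (p : ℝ) ^ k := by positivity
  have hy : ‖x * (p : ℚ_[p]) ^ k‖ ≤ 1 := by
    rw [norm_mul, norm_pow, Padic.norm_p, inv_pow, ← div_eq_mul_inv, div_le_one hpk]
    exact hk.le
  let y : ℤ_[p] := ⟨x * (p : ℚ_[p]) ^ k, hy⟩
  obtain ⟨z, hz⟩ := Ideal.mem_span_singleton.mp (PadicInt.appr_spec k y)
  have hz' : x * (p : ℚ_[p]) ^ k - (y.appr k : ℚ_[p]) = (p : ℚ_[p]) ^ k * (z : ℚ_[p]) := by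
    have h := congrArg (fun t : ℤ_[p] => (t : ℚ_[p])) hz
    simpa only [PadicInt.coe_sub, PadicInt.coe_mul, PadicInt.coe_pow, PadicInt.coe_natCast] using h
  refine ⟨(y.appr k : ℚ) / (p : ℚ) ^ k, ⟨y.appr k, k, rfl⟩, ?_⟩
  have hx : x - (((y.appr k : ℚ) / (p : ℚ) ^ k : ℚ) : ℚ_[p]) = (z : ℚ_[p]) := by
    push_cast
    have hpk' : (p : ℚ_[p]) ^ k ≠ 0 := pow_ne_zero _ hp0
    field_simp
    linear_combination hz'
  rw [hx]
  exact z.2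

/-- A rational number with denominator a power of `p` which is congruent to `x` modulo `ℤ_p`
(it is unique modulo `ℤ`). -/
def fractionalPart {p : ℕ} [Fact p.Prime] (x : ℚ_[p]) : ℚ :=
  (exists_fractionalPart x).choose

/-- The additive character `Ψ : ℚ_p → ℚ_p / ℤ_p ↪ ℚ / ℤ → ℂˣ`, `b ↦ exp (2 π i b)`. -/
def psi {p : ℕ} [Fact p.Prime] (x : ℚ_[p]) : ℂ :=
  Complex.exp (2 * Real.pi * Complex.I * ((fractionalPart x : ℚ) : ℂ))

instance instMeasurableSpacePadic {p : ℕ} [Fact p.Prime] : MeasurableSpace ℚ_[p] :=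
  borel ℚ_[p]

instance instBorelSpacePadic {p : ℕ} [Fact p.Prime] : BorelSpace ℚ_[p] := ⟨rfl⟩

/-- The Haar measure of `ℚ_p`, normalized by `vol ℤ_p = 1`. Accordingly `volume` on
`Fin n → ℚ_[p]` is the product measure, i.e. the Haar measure `d^n x` with `vol ℤ_p^n = 1`. -/
instance instMeasureSpacePadic {p : ℕ} [Fact p.Prime] : MeasureSpace ℚ_[p] where
  volume := Measure.addHaarMeasure
    { carrier := Metric.closedBall (0 : ℚ_[p]) 1
      isCompact' := isCompact_closedBall 0 1
      interior_nonempty' := ⟨0, Metric.ball_subset_interior_closedBall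
        (Metric.mem_ball_self one_pos)⟩ }

/-! ### Schwartz--Bruhat functions and the Fourier transform -/

/-- The pairing `x · y = x₁ y₁ + ⋯ + xₙ yₙ`. -/
def pairing {p : ℕ} [Fact p.Prime] {n : ℕ} (x y : Fin n → ℚ_[p]) : ℚ_[p] :=
  ∑ i, x i * y i

/-- The Schwartz--Bruhat space `S`: locally constant functions with compact support. -/
def IsSchwartzBruhat {p : ℕ} [Fact p.Prime] {n : ℕ} (φ : (Fin n → ℚ_[p]) → ℂ) : Prop :=
  IsLocallyConstant φ ∧ HasCompactSupport φ

/-- `(𝓕 φ)(ξ) = ∫ Ψ(-x·ξ) φ(x) d^n x`. -/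
def fourier {p : ℕ} [Fact p.Prime] {n : ℕ} (φ : (Fin n → ℚ_[p]) → ℂ)
    (ξ : Fin n → ℚ_[p]) : ℂ :=
  ∫ x, psi (-pairing x ξ) * φ x

/-- `(𝓕⁻¹ φ)(x) = ∫ Ψ(x·ξ) φ(ξ) d^n ξ`. -/
def fourierInv {p : ℕ} [Fact p.Prime] {n : ℕ} (φ : (Fin n → ℚ_[p]) → ℂ)
    (x : Fin n → ℚ_[p]) : ℂ :=
  ∫ ξ, psi (pairing x ξ) * φ ξ

/-- `G` is (a representative of) the Fourier transform of `g ∈ L²`, where the Fourier transform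
on `L²` is the continuous extension of `𝓕 : S → S`. -/
def IsL2Fourier {p : ℕ} [Fact p.Prime] {n : ℕ} (g G : (Fin n → ℚ_[p]) → ℂ) : Prop :=
  MemLp g 2 ∧ MemLp G 2 ∧
    ∃ φ : ℕ → (Fin n → ℚ_[p]) → ℂ, (∀ k, IsSchwartzBruhat (φ k)) ∧
      Tendsto (fun k => eLpNorm (φ k - g) 2 volume) atTop (𝓝 0) ∧
      Tendsto (fun k => eLpNorm (fourier (φ k) - G) 2 volume) atTop (𝓝 0)

/-! ### Quasielliptic polynomials and their operators -/

/-- `f` is a quasielliptic polynomial of degree `d` with respect to the weights `w`. -/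
structure IsQuasielliptic {p : ℕ} [Fact p.Prime] {n : ℕ} (f : MvPolynomial (Fin n) ℚ_[p])
    (w : Fin n → ℕ) (d : ℕ) : Prop where
  nonconstant : ∀ c : ℚ_[p], f ≠ MvPolynomial.C c
  weight_pos : ∀ i, 0 < w i
  homogeneous : ∀ c : ℚ_[p], c ≠ 0 → ∀ ξ : Fin n → ℚ_[p],
    MvPolynomial.eval (fun i => c ^ w i * ξ i) f = c ^ d * MvPolynomial.eval ξ f
  eval_eq_zero_iff : ∀ ξ : Fin n → ℚ_[p], MvPolynomial.eval ξ f = 0 ↔ ξ = 0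

/-- Elliptic polynomials: quasielliptic with respect to `(1, …, 1)`. -/
def IsElliptic {p : ℕ} [Fact p.Prime] {n : ℕ} (f : MvPolynomial (Fin n) ℚ_[p]) (d : ℕ) : Prop :=
  IsQuasielliptic f (fun _ => 1) d

/-- The symbol `|f(ξ)|_p^α`. -/
def symbol {p : ℕ} [Fact p.Prime] {n : ℕ} (f : MvPolynomial (Fin n) ℚ_[p]) (α : ℝ)
    (ξ : Fin n → ℚ_[p]) : ℝ :=
  ‖MvPolynomial.eval ξ f‖ ^ α

/-- `v` lies in the `L²`-domain of `f(D, α) = 𝓕⁻¹ ∘ |f|_p^α ∘ 𝓕`, and `f(D, α) v = g`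
(almost everywhere). -/
def IsPseudoDiff {p : ℕ} [Fact p.Prime] {n : ℕ} (f : MvPolynomial (Fin n) ℚ_[p]) (α : ℝ)
    (v g : (Fin n → ℚ_[p]) → ℂ) : Prop :=
  ∃ V : (Fin n → ℚ_[p]) → ℂ, IsL2Fourier v V ∧ IsL2Fourier g (fun ξ => (symbol f α ξ : ℂ) * V ξ)

/-! ### The spaces `Φ` and `H̃_∞` -/

/-- `Ξ(ξ) = ∑ |ξ_i|_p^{d / w_i}`. -/
def bigXi {p : ℕ} [Fact p.Prime] {n : ℕ} (w : Fin n → ℕ) (d : ℕ) (ξ : Fin n → ℚ_[p]) : ℝ :=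
  ∑ i, ‖ξ i‖ ^ ((d : ℝ) / (w i : ℝ))

/-- The norm `‖φ‖_β = (∫ Ξ^{2β} |𝓕 φ|² d^n ξ)^{1/2}` on `S`. -/
def betaNorm {p : ℕ} [Fact p.Prime] {n : ℕ} (w : Fin n → ℕ) (d : ℕ) (β : ℝ)
    (φ : (Fin n → ℚ_[p]) → ℂ) : ℝ :=
  Real.sqrt (∫ ξ, bigXi w d ξ ^ (2 * β) * ‖fourier φ ξ‖ ^ 2)

/-- The Lizorkin space `Φ = {φ ∈ S : 𝓕 φ (0) = 0}`. -/
def IsLizorkin {p : ℕ} [Fact p.Prime] {n : ℕ} (φ : (Fin n → ℚ_[p]) → ℂ) : Prop :=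
  IsSchwartzBruhat φ ∧ fourier φ 0 = 0

/-- The function `v` belongs to `H̃_∞`, the completion of `Φ` with respect to the family of norms
`‖·‖_β`, `β = 0, 1, 2, …`. As `‖·‖_0` is the `L²` norm, the element of the completion given by a
sequence that is Cauchy in every `‖·‖_β` is identified with the `L²` limit of that sequence. -/
def MemHInfty {p : ℕ} [Fact p.Prime] {n : ℕ} (w : Fin n → ℕ) (d : ℕ)
    (v : (Fin n → ℚ_[p]) → ℂ) : Prop :=
  MemLp v 2 ∧
    ∃ φ : ℕ → (Fin n → ℚ_[p]) → ℂ, (∀ k, IsLizorkin (φ k)) ∧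
      (∀ β : ℕ, ∀ ε : ℝ, 0 < ε → ∃ N : ℕ, ∀ k ≥ N, ∀ l ≥ N,
        betaNorm w d (β : ℝ) (φ k - φ l) < ε) ∧
      Tendsto (fun k => eLpNorm (φ k - v) 2 volume) atTop (𝓝 0)

/-! ### The Cauchy problem -/

/-- `e^{-t |f(ξ)|_p^α}`. -/
def heatSymbol {p : ℕ} [Fact p.Prime] {n : ℕ} (f : MvPolynomial (Fin n) ℚ_[p]) (α t : ℝ)
    (ξ : Fin n → ℚ_[p]) : ℂ :=
  (Real.exp (-t * symbol f α ξ) : ℂ)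

/-- `Z(x, t) = ∫ Ψ(x·ξ) e^{-t |f(ξ)|_p^α} d^n ξ`. -/
def heatKernel {p : ℕ} [Fact p.Prime] {n : ℕ} (f : MvPolynomial (Fin n) ℚ_[p]) (α : ℝ)
    (x : Fin n → ℚ_[p]) (t : ℝ) : ℂ :=
  fourierInv (heatSymbol f α t) x

/-- `u(x, t) = ∫ Z(η, t) φ(x - η) d^n η` for `t > 0`, and `u(x, 0) = φ(x)`. -/
def heatSolution {p : ℕ} [Fact p.Prime] {n : ℕ} (f : MvPolynomial (Fin n) ℚ_[p]) (α : ℝ)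
    (φ : (Fin n → ℚ_[p]) → ℂ) (x : Fin n → ℚ_[p]) (t : ℝ) : ℂ :=
  if 0 < t then ∫ η, heatKernel f α η t * φ (x - η) else φ x

/-- `u` is a classical solution on `ℚ_p^n × [0, ∞)` of `∂_t u + f(D, α) u = 0`, `u(·, 0) = φ`:
it is jointly continuous up to `t = 0`, where it takes the value `φ`; for `t > 0` each `u(·, t)` is
in the domain of `f(D, α)`, `f(D, α) u(·, t)` has a representative `g(·, t)` that is continuous in
`(x, t)`, and at every point `∂_t u` exists and equals `-g`. -/
structure IsClassicalSolution {p : ℕ} [Fact p.Prime] {n : ℕ} (f : MvPolynomial (Fin n) ℚ_[p])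
    (α : ℝ) (φ : (Fin n → ℚ_[p]) → ℂ) (u : (Fin n → ℚ_[p]) → ℝ → ℂ) : Prop where
  continuousOn : ContinuousOn (fun q : (Fin n → ℚ_[p]) × ℝ => u q.1 q.2) {q | 0 ≤ q.2}
  initial : ∀ x, u x 0 = φ x
  equation : ∃ g : (Fin n → ℚ_[p]) → ℝ → ℂ,
    ContinuousOn (fun q : (Fin n → ℚ_[p]) × ℝ => g q.1 q.2) {q | 0 < q.2} ∧
    ∀ t : ℝ, 0 < t →
      IsPseudoDiff f α (fun x => u x t) (fun x => g x t) ∧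
      ∀ x, HasDerivAt (fun s => u x s) (-g x t) t

end

end PadicPDE

/-!
The Cauchy problem is solved on the Fourier side. The symbol `a = |f|_p^α` of an elliptic polynomial
`f` is homogeneous of degree `γ = d α > 0`, comparable with `‖ξ‖ ^ γ`, and constant on a ball of
radius proportional to `‖ξ‖` around each `ξ ≠ 0` (`IsElliptic.isHomogeneousSymbol`); nothing else
about `f` is used. All of this follows from compactness of the unit sphere and homogeneity.

*Fourier analysis.* Haar measure scales by `‖c‖ ^ n` (`map_smul_volume`), and a function invariant
under a translation `h` with `Ψ(x·h) ≠ 1` is orthogonal to the character `Ψ(x·)`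
(`fourierInv_eq_zero_of_periodic`). This gives the transform of a ball, hence inversion and
Plancherel's theorem for Schwartz--Bruhat functions, and by density (evaluation at representatives
of the cosets of a small ball) the Fourier transform on `L²` (`exists_isL2Fourier`).

*Multipliers.* Let `Φ` be the transform of the initial value `φ`. The functions `e^{-ta}` and
`a e^{-ta}` are bounded, square-integrable, and locally constant away from `0`. If Schwartz--Bruhat
functions `χ_k` vanish near `0` and tend to `Φ` in `L²`, then multiplying them by such a function
`m` gives Schwartz--Bruhat functions again. Their inverse transforms converge pointwise, by
Cauchy--Schwarz, and in `L²`, by Plancherel and Fatou, to the inverse transform of `m Φ`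
(`isL2Fourier_fourierInv_mul`). They are Lizorkin functions, because `m χ_k` vanishes at `0`, and
they are Cauchy in every `‖·‖_β`, because `Ξ^β e^{-ta}` is bounded; this proves membership in `H̃_∞`.

*The equation.* For `t > 0` the convolution `Z(·, t) * φ` is the inverse transform of `e^{-ta} Φ`
(`integral_fourierInv_expSymbol_mul_comp_sub`), so continuity in `(x, t)` and the differential
equation follow from dominated convergence.

*The initial value.* The kernel satisfies `|Z(x, t)| ≤ C t ‖x‖ ^ (-γ - n)`: on a ball of radius
proportional to `1 / ‖x‖` the symbol may be replaced by `1` at a cost of `t a(ξ)`, and what remains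
is invariant under a translation on which `Ψ(x·)` is not trivial
(`exists_norm_fourierInv_expSymbol_le`). With the scaling `Z(c x, t ‖c‖ ^ γ) = ‖c‖ ^ (-n) Z(x, t)`,
which reduces every time to one in `[1, p ^ γ]`, and `∫ Z = 1`, the kernels form an approximate
identity as `t → 0` (`tendsto_integral_fourierInv_expSymbol_mul`).
-/

namespace PadicPDE

variable {p : ℕ} [Fact p.Prime] {n : ℕ}

/-! ### The additive character -/

theorem fractionalPart_spec (x : ℚ_[p]) :
    (∃ a k : ℕ, fractionalPart x = (a : ℚ) / (p : ℚ) ^ k) ∧ ‖x - (fractionalPart x : ℚ_[p])‖ ≤ 1 :=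
  (exists_fractionalPart x).choose_spec

/-- A rational number with denominator a power of `p` that is a `p`-adic integer is an integer. -/
theorem exists_int_eq_div_pow {m : ℤ} {k : ℕ} (h : ‖(((m : ℚ) / (p : ℚ) ^ k : ℚ) : ℚ_[p])‖ ≤ 1) :
    ∃ z : ℤ, (m : ℚ) / (p : ℚ) ^ k = z := by
  have hp0 : (p : ℚ) ≠ 0 := by exact_mod_cast (Fact.out : p.Prime).ne_zero
  have hpr : (0 : ℝ) < p := by exact_mod_cast (Fact.out : p.Prime).pos
  have h1 : ‖(m : ℚ_[p])‖ ≤ (p : ℝ) ^ (-(k : ℤ)) := by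
    push_cast at h
    rw [norm_div, norm_pow, Padic.norm_p, inv_pow, div_inv_eq_mul] at h
    rw [zpow_neg, zpow_natCast, ← one_div, le_div_iff₀ (by positivity)]
    exact h
  rw [Padic.norm_int_le_pow_iff_dvd] at h1
  obtain ⟨z, hz⟩ := h1
  refine ⟨z, ?_⟩
  rw [hz]
  push_cast
  field_simp

/-- Fractional parts are unique modulo `ℤ`; hence `psi` does not depend on the choice made in
`fractionalPart`. -/
theorem fractionalPart_congr {x : ℚ_[p]} {q : ℚ} (hq : ∃ (m : ℤ) (k : ℕ), q = (m : ℚ) / (p : ℚ) ^ k)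
    (hx : ‖x - (q : ℚ_[p])‖ ≤ 1) : ∃ z : ℤ, fractionalPart x = q + z := by
  obtain ⟨⟨a, k, hak⟩, h⟩ := fractionalPart_spec x
  obtain ⟨m, l, hml⟩ := hq
  have hp0 : (p : ℚ) ≠ 0 := by exact_mod_cast (Fact.out : p.Prime).ne_zero
  have key : fractionalPart x - q =
      (((a : ℤ) * p ^ l - m * p ^ k : ℤ) : ℚ) / (p : ℚ) ^ (k + l) := by
    rw [hak, hml, pow_add]; push_cast; field_simp
  have hn : ‖((fractionalPart x - q : ℚ) : ℚ_[p])‖ ≤ 1 := by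
    have : ((fractionalPart x - q : ℚ) : ℚ_[p]) = (x - q) - (x - fractionalPart x) := by
      push_cast; ring
    rw [this, sub_eq_add_neg]
    exact (IsUltrametricDist.norm_add_le_max _ _).trans (max_le hx (by rwa [norm_neg]))
  rw [key] at hn
  obtain ⟨z, hz⟩ := exists_int_eq_div_pow hn
  exact ⟨z, by rw [← hz, ← key]; ring⟩

theorem psi_eq_of_norm_sub_le {x : ℚ_[p]} {q : ℚ}
    (hq : ∃ (m : ℤ) (k : ℕ), q = (m : ℚ) / (p : ℚ) ^ k)
    (hx : ‖x - (q : ℚ_[p])‖ ≤ 1) : psi x = Complex.exp (2 * Real.pi * Complex.I * (q : ℂ)) := by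
  obtain ⟨z, hz⟩ := fractionalPart_congr hq hx
  rw [psi, hz, Complex.exp_eq_exp_iff_exists_int]
  exact ⟨z, by push_cast; ring⟩

theorem psi_add (x y : ℚ_[p]) : psi (x + y) = psi x * psi y := by
  obtain ⟨⟨a, k, hak⟩, hx⟩ := fractionalPart_spec x
  obtain ⟨⟨b, l, hbl⟩, hy⟩ := fractionalPart_spec y
  have hp0 : (p : ℚ) ≠ 0 := by exact_mod_cast (Fact.out : p.Prime).ne_zero
  rw [psi_eq_of_norm_sub_le (q := fractionalPart x + fractionalPart y), psi, psi, ← Complex.exp_add]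
  · congr 1; push_cast; ring
  · refine ⟨a * p ^ l + b * p ^ k, k + l, ?_⟩
    rw [hak, hbl, pow_add]; push_cast; field_simp
  · have : x + y - ((fractionalPart x + fractionalPart y : ℚ) : ℚ_[p]) =
      (x - fractionalPart x) + (y - fractionalPart y) := by push_cast; ring
    rw [this]
    exact (IsUltrametricDist.norm_add_le_max _ _).trans (max_le hx hy)

theorem psi_eq_one_iff {x : ℚ_[p]} : psi x = 1 ↔ ‖x‖ ≤ 1 := by
  constructor
  · intro h
    rw [psi, Complex.exp_eq_one_iff] at h
    obtain ⟨z, hz⟩ := h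
    have h2 : (2 * Real.pi * Complex.I : ℂ) ≠ 0 := Complex.two_pi_I_ne_zero
    have hz' : fractionalPart x = z := by
      have : ((fractionalPart x : ℚ) : ℂ) = (z : ℂ) := mul_left_cancel₀ h2 (by rw [hz]; ring)
      exact_mod_cast this
    have h3 := (fractionalPart_spec x).2
    rw [hz'] at h3
    have : x = (x - ((z : ℚ) : ℚ_[p])) + ((z : ℤ) : ℚ_[p]) := by push_cast; ring
    rw [this]
    exact (IsUltrametricDist.norm_add_le_max _ _).trans (max_le h3 (Padic.norm_int_le_one z))
  · intro h
    rw [psi_eq_of_norm_sub_le (q := 0) ⟨0, 0, by simp⟩ (by simpa using h)]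
    simp

@[simp] theorem norm_psi (x : ℚ_[p]) : ‖psi x‖ = 1 := by
  have : (2 * Real.pi * Complex.I * ((fractionalPart x : ℚ) : ℂ)) =
    ((2 * Real.pi * (fractionalPart x : ℝ) : ℝ) : ℂ) * Complex.I := by push_cast; ring
  rw [psi, this, Complex.norm_exp_ofReal_mul_I]

theorem psi_neg (x : ℚ_[p]) : psi (-x) = (starRingEnd ℂ) (psi x) := by
  have h : psi (-x) * psi x = 1 := by rw [← psi_add, psi_eq_one_iff]; simp
  have h2 : (starRingEnd ℂ) (psi x) * psi x = 1 := by
    rw [mul_comm, Complex.mul_conj, Complex.normSq_eq_norm_sq]; simp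
  have h3 : psi x ≠ 0 := by rw [← norm_ne_zero_iff]; simp
  exact mul_right_cancel₀ h3 (h.trans h2.symm)

theorem continuous_psi : Continuous (psi (p := p)) := by
  refine IsLocallyConstant.continuous ?_
  rw [IsLocallyConstant.iff_eventually_eq]
  intro x
  filter_upwards [Metric.ball_mem_nhds x one_pos] with y hy
  rw [Metric.mem_ball, dist_eq_norm] at hy
  have : y = x + (y - x) := by ring
  rw [this, psi_add, psi_eq_one_iff.2 hy.le, mul_one]

/-! ### The pairing -/

theorem pairing_add_left (x y z : Fin n → ℚ_[p]) :
    pairing (x + y) z = pairing x z + pairing y z := by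
  simp [pairing, add_mul, Finset.sum_add_distrib]

theorem pairing_add_right (x y z : Fin n → ℚ_[p]) :
    pairing x (y + z) = pairing x y + pairing x z := by
  simp [pairing, mul_add, Finset.sum_add_distrib]

@[simp] theorem pairing_neg_right (x y : Fin n → ℚ_[p]) : pairing x (-y) = -pairing x y := by
  simp [pairing]

@[simp] theorem pairing_neg_left (x y : Fin n → ℚ_[p]) : pairing (-x) y = -pairing x y := by
  simp [pairing]

theorem pairing_smul_left (c : ℚ_[p]) (x y : Fin n → ℚ_[p]) :
    pairing (c • x) y = c * pairing x y := by
  simp [pairing, Finset.mul_sum, mul_assoc]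

theorem pairing_smul_right (c : ℚ_[p]) (x y : Fin n → ℚ_[p]) :
    pairing x (c • y) = c * pairing x y := by
  simp [pairing, Finset.mul_sum, mul_left_comm]

theorem pairing_comm (x y : Fin n → ℚ_[p]) : pairing x y = pairing y x := by
  simp [pairing, mul_comm]

theorem norm_pairing_le (x y : Fin n → ℚ_[p]) : ‖pairing x y‖ ≤ ‖x‖ * ‖y‖ := by
  refine IsUltrametricDist.norm_sum_le_of_forall_le_of_nonneg (by positivity) fun i _ => ?_
  rw [norm_mul]
  exact mul_le_mul (norm_le_pi_norm x i) (norm_le_pi_norm y i) (norm_nonneg _) (norm_nonneg _)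

theorem continuous_pairing :
    Continuous fun q : (Fin n → ℚ_[p]) × (Fin n → ℚ_[p]) => pairing q.1 q.2 := by
  unfold pairing; fun_prop

theorem exists_norm_apply_eq {x : Fin n → ℚ_[p]} (hx : x ≠ 0) : ∃ i, ‖x i‖ = ‖x‖ := by
  by_contra! hc
  have : ‖x‖ < ‖x‖ := (pi_norm_lt_iff (norm_pos_iff.2 hx)).2 fun i =>
    lt_of_le_of_ne (norm_le_pi_norm x i) (hc i)
  exact lt_irrefl _ this

/-! ### The Haar measure -/

instance : (volume : Measure ℚ_[p]).IsAddHaarMeasure :=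
  inferInstanceAs (Measure.addHaarMeasure _).IsAddHaarMeasure

theorem volume_closedBall_zero_one : volume (Metric.closedBall (0 : ℚ_[p]) 1) = 1 :=
  Measure.addHaarMeasure_self

/-- A ball of radius `p ^ j` is the union of `p` translates of the ball of radius `p ^ (j - 1)`. -/
theorem closedBall_zpow_eq_biUnion (j : ℤ) :
    Metric.closedBall (0 : ℚ_[p]) ((p : ℝ) ^ j) =
      ⋃ a ∈ Finset.range p, (fun x => (a : ℚ_[p]) * (p : ℚ_[p]) ^ (-j) + x) ''
        Metric.closedBall (0 : ℚ_[p]) ((p : ℝ) ^ (j - 1)) := by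
  have hp1 : (1 : ℝ) < p := by exact_mod_cast (Fact.out : p.Prime).one_lt
  have hp0 : (p : ℚ_[p]) ≠ 0 := by exact_mod_cast (Fact.out : p.Prime).ne_zero
  ext x
  simp only [Finset.mem_range, Set.mem_iUnion, Set.mem_image, mem_closedBall_zero_iff, exists_prop]
  constructor
  · intro hx
    have hy : ‖x * (p : ℚ_[p]) ^ j‖ ≤ 1 := by
      rw [norm_mul, norm_zpow, Padic.norm_p, inv_zpow, ← div_eq_mul_inv, div_le_one (by positivity)]
      exact hx
    obtain ⟨y, hxy⟩ : ∃ y : ℤ_[p], (y : ℚ_[p]) = x * (p : ℚ_[p]) ^ j := ⟨⟨_, hy⟩, rfl⟩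
    obtain ⟨a, ha, hm⟩ := PadicInt.exists_mem_range y
    refine ⟨a, ha, x - a * (p : ℚ_[p]) ^ (-j), ?_, by ring⟩
    rw [IsLocalRing.mem_maximalIdeal, PadicInt.mem_nonunits] at hm
    have h1 : ‖y - a‖ ≤ (p : ℝ) ^ (-1 : ℤ) := by
      rw [PadicInt.norm_le_pow_iff_norm_lt_pow_add_one]; simpa using hm
    have h2 : x - a * (p : ℚ_[p]) ^ (-j) = ((y - a : ℤ_[p]) : ℚ_[p]) * (p : ℚ_[p]) ^ (-j) := by
      push_cast
      rw [hxy, sub_mul, mul_assoc, ← zpow_add₀ hp0]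
      simp
    rw [h2, norm_mul, norm_zpow, Padic.norm_p, inv_zpow, zpow_neg, inv_inv, zpow_sub_one₀
      (by positivity), mul_comm]
    refine mul_le_mul_of_nonneg_left ?_ (by positivity)
    rwa [zpow_neg_one] at h1
  · rintro ⟨a, -, y, hy, rfl⟩
    refine (IsUltrametricDist.norm_add_le_max _ _).trans (max_le ?_ ?_)
    · rw [norm_mul, norm_zpow, Padic.norm_p, inv_zpow, zpow_neg, inv_inv]
      refine mul_le_of_le_one_left (by positivity) ?_
      exact_mod_cast Padic.norm_int_le_one (p := p) (a : ℤ)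
    · exact hy.trans (zpow_le_zpow_right₀ hp1.le (by omega))

theorem volume_closedBall_zpow_succ (j : ℤ) :
    volume (Metric.closedBall (0 : ℚ_[p]) ((p : ℝ) ^ j)) =
      p * volume (Metric.closedBall (0 : ℚ_[p]) ((p : ℝ) ^ (j - 1))) := by
  have hp1 : (1 : ℝ) < p := by exact_mod_cast (Fact.out : p.Prime).one_lt
  have hp0 : (p : ℚ_[p]) ≠ 0 := by exact_mod_cast (Fact.out : p.Prime).ne_zero
  rw [closedBall_zpow_eq_biUnion, measure_biUnion_finset]
  · simp only [Set.image_add_left, measure_preimage_add, Finset.sum_const, Finset.card_range,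
      nsmul_eq_mul]
  · intro a ha b hb hab
    rw [Function.onFun, Set.disjoint_left]
    rintro _ ⟨x, hx, rfl⟩ ⟨y, hy, hxy⟩
    rw [mem_closedBall_zero_iff] at hx hy
    apply hab
    have h1 : (((a : ℤ) - (b : ℤ) : ℤ) : ℚ_[p]) * (p : ℚ_[p]) ^ (-j) = y + -x := by
      push_cast; linear_combination -hxy
    have h2 : ‖y + -x‖ ≤ (p : ℝ) ^ (j - 1) :=
      (IsUltrametricDist.norm_add_le_max _ _).trans (max_le hy (by rwa [norm_neg]))
    rw [← h1, norm_mul, norm_zpow, Padic.norm_p, inv_zpow, zpow_neg, inv_inv, zpow_sub_one₀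
      (by positivity), mul_comm, mul_le_mul_iff_right₀ (by positivity)] at h2
    have h3 : ((p : ℤ) ^ 1) ∣ (a : ℤ) - b := by
      rw [← Padic.norm_int_le_pow_iff_dvd]; simpa using h2
    rw [pow_one] at h3
    simp only [Finset.coe_range, Set.mem_Iio] at ha hb
    have := Int.eq_zero_of_abs_lt_dvd h3 (by rw [abs_lt]; omega)
    omega
  · intro a _
    rw [Set.image_add_left]
    exact (measurable_const_add _) Metric.isClosed_closedBall.measurableSet

theorem volume_closedBall_zpow (j : ℤ) :
    volume (Metric.closedBall (0 : ℚ_[p]) ((p : ℝ) ^ j)) = ENNReal.ofReal ((p : ℝ) ^ j) := by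
  have hpr : (0 : ℝ) < p := by exact_mod_cast (Fact.out : p.Prime).pos
  have hp0 : (p : ENNReal) ≠ 0 := by exact_mod_cast (Fact.out : p.Prime).ne_zero
  have hpt : (p : ENNReal) ≠ ⊤ := ENNReal.natCast_ne_top p
  have hmul : ∀ j : ℤ, ENNReal.ofReal ((p : ℝ) ^ j) = p * ENNReal.ofReal ((p : ℝ) ^ (j - 1)) := by
    intro j
    rw [← ENNReal.ofReal_natCast p, ← ENNReal.ofReal_mul hpr.le, zpow_sub_one₀ hpr.ne']
    congr 1
    field_simp
  induction j using Int.induction_on with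
  | zero => simpa using volume_closedBall_zero_one
  | succ i ih => rw [volume_closedBall_zpow_succ, hmul, add_sub_cancel_right, ih]
  | pred i ih =>
    rw [volume_closedBall_zpow_succ, hmul] at ih
    exact (ENNReal.mul_right_inj hp0 hpt).1 ih

theorem volume_pi_closedBall_norm {c : ℚ_[p]} (hc : c ≠ 0) :
    volume (Metric.closedBall (0 : Fin n → ℚ_[p]) ‖c‖) = ENNReal.ofReal (‖c‖ ^ n) := by
  have hpr : (0 : ℝ) < p := by exact_mod_cast (Fact.out : p.Prime).pos
  rw [volume_pi, Measure.pi_closedBall _ _ (norm_nonneg _)]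
  have h : volume (Metric.closedBall (0 : ℚ_[p]) ‖c‖) = ENNReal.ofReal ‖c‖ := by
    rw [Padic.norm_eq_zpow_neg_valuation hc, volume_closedBall_zpow]
  simp [h, ENNReal.ofReal_pow]

theorem measureReal_pi_closedBall_norm {c : ℚ_[p]} (hc : c ≠ 0) :
    volume.real (Metric.closedBall (0 : Fin n → ℚ_[p]) ‖c‖) = ‖c‖ ^ n := by
  rw [measureReal_def, volume_pi_closedBall_norm hc, ENNReal.toReal_ofReal (by positivity)]

/-- Haar measure is unique up to a scalar, and the scalar can be read off from the unit ball. -/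
theorem map_smul_volume {c : ℚ_[p]} (hc : c ≠ 0) :
    Measure.map (fun x : Fin n → ℚ_[p] => c • x) volume =
      ENNReal.ofReal ((‖c‖ ^ n)⁻¹) • (volume : Measure (Fin n → ℚ_[p])) := by
  let e : (Fin n → ℚ_[p]) ≃ₜ (Fin n → ℚ_[p]) := Homeomorph.smulOfNeZero c hc
  have hμ : (Measure.map (fun x : Fin n → ℚ_[p] => c • x) volume).IsAddHaarMeasure :=
    (DistribMulAction.toAddEquiv₀ (Fin n → ℚ_[p]) c hc).isAddHaarMeasure_map volume
      e.continuous e.symm.continuous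
  set κ := (Measure.map (fun x : Fin n → ℚ_[p] => c • x) volume).addHaarScalarFactor volume with hκ
  have h1 := Measure.isAddLeftInvariant_eq_smul
    (Measure.map (fun x : Fin n → ℚ_[p] => c • x) volume) volume
  rw [← hκ] at h1
  have h2 : Measure.map (fun x : Fin n → ℚ_[p] => c • x) volume (Metric.closedBall 0 ‖c‖) =
      (κ • volume : Measure (Fin n → ℚ_[p])) (Metric.closedBall 0 ‖c‖) := by rw [← h1]
  have hm : Measurable (fun x : Fin n → ℚ_[p] => c • x) := e.continuous.measurable
  rw [Measure.map_apply hm Metric.isClosed_closedBall.measurableSet,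
    Measure.smul_apply, volume_pi_closedBall_norm hc] at h2
  have h3 : (fun x : Fin n → ℚ_[p] => c • x) ⁻¹' Metric.closedBall 0 ‖c‖ =
      Metric.closedBall 0 ‖(1 : ℚ_[p])‖ := by
    ext x
    have := norm_pos_iff.2 hc
    simp [norm_smul, this]
  rw [h3, volume_pi_closedBall_norm one_ne_zero] at h2
  have hcn : (0 : ℝ) < ‖c‖ ^ n := by have := norm_pos_iff.2 hc; positivity
  have h4 : (κ : ENNReal) = ENNReal.ofReal ((‖c‖ ^ n)⁻¹) := by
    rw [ENNReal.ofReal_inv_of_pos hcn]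
    refine ENNReal.eq_inv_of_mul_eq_one_left ?_
    rw [ENNReal.smul_def, smul_eq_mul] at h2
    rw [← h2]; simp
  rw [h1, ← h4]
  rfl

theorem integral_comp_smul {c : ℚ_[p]} (hc : c ≠ 0) (F : (Fin n → ℚ_[p]) → ℂ) :
    ∫ x, F (c • x) = ((‖c‖ ^ n)⁻¹ : ℝ) • ∫ x, F x := by
  have he : MeasurableEmbedding (fun x : Fin n → ℚ_[p] => c • x) :=
    (Homeomorph.smulOfNeZero c hc).measurableEmbedding
  rw [← he.integral_map, map_smul_volume hc, integral_smul_measure, ENNReal.toReal_ofReal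
    (by positivity)]

theorem integrable_comp_smul {c : ℚ_[p]} (hc : c ≠ 0) {F : (Fin n → ℚ_[p]) → ℂ}
    (hF : Integrable F) : Integrable fun x => F (c • x) := by
  have he : MeasurableEmbedding (fun x : Fin n → ℚ_[p] => c • x) :=
    (Homeomorph.smulOfNeZero c hc).measurableEmbedding
  refine he.integrable_map_iff.1 ?_
  rw [map_smul_volume hc]
  exact hF.smul_measure ENNReal.ofReal_ne_top

theorem natCast_prime_ne_zero : (p : ℚ_[p]) ≠ 0 := by exact_mod_cast (Fact.out : p.Prime).ne_zero

theorem one_lt_natCast_prime (p : ℕ) [Fact p.Prime] : (1 : ℝ) < p := by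
  exact_mod_cast (Fact.out : p.Prime).one_lt

theorem norm_prime_zpow (j : ℤ) : ‖(p : ℚ_[p]) ^ (-j)‖ = (p : ℝ) ^ j := by
  rw [norm_zpow, Padic.norm_p, inv_zpow, zpow_neg, inv_inv]

/-- Comparison with a geometric series over the balls of radius `p ^ k`. -/
theorem integrable_max_one_norm_rpow {s : ℝ} (hs : (n : ℝ) < s) :
    Integrable fun x : Fin n → ℚ_[p] => (max 1 ‖x‖) ^ (-s) := by
  have hp1 := one_lt_natCast_prime p
  have hpr : (0 : ℝ) < p := by positivity
  have hcont : Continuous fun x : Fin n → ℚ_[p] => (max 1 ‖x‖) ^ (-s) :=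
    (continuous_const.max continuous_norm).rpow_const fun x =>
      Or.inl (lt_of_lt_of_le one_pos (le_max_left _ _)).ne'
  refine ⟨hcont.aestronglyMeasurable, ?_⟩
  let b : ℕ → ENNReal := fun k => ENNReal.ofReal ((p : ℝ) ^ (-(s * k)))
  let B : ℕ → Set (Fin n → ℚ_[p]) := fun k => Metric.closedBall 0 ((p : ℝ) ^ (k + 1))
  have hB : ∀ k, volume (B k) = ENNReal.ofReal (((p : ℝ) ^ (k + 1)) ^ n) := by
    intro k
    have hc : (p : ℚ_[p]) ^ (-((k : ℤ) + 1)) ≠ 0 := zpow_ne_zero _ natCast_prime_ne_zero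
    have h := volume_pi_closedBall_norm (n := n) hc
    rwa [norm_prime_zpow, show ((k : ℤ) + 1) = ((k + 1 : ℕ) : ℤ) by push_cast; rfl,
      zpow_natCast] at h
  have hle : ∀ x : Fin n → ℚ_[p], ‖(max 1 ‖x‖) ^ (-s)‖ₑ ≤
      ∑' k, (B k).indicator (fun _ => b k) x := by
    intro x
    obtain ⟨k, hk1, hk2⟩ := exists_nat_pow_near (le_max_left 1 ‖x‖) hp1
    refine le_trans ?_ (ENNReal.le_tsum k)
    have hx : x ∈ B k := by
      rw [mem_closedBall_zero_iff]; exact (le_max_right _ _).trans hk2.le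
    rw [Set.indicator_of_mem hx, Real.enorm_of_nonneg (by positivity)]
    refine ENNReal.ofReal_le_ofReal ?_
    have hs0 : 0 ≤ s := (Nat.cast_nonneg n).trans hs.le
    calc (max 1 ‖x‖) ^ (-s) ≤ ((p : ℝ) ^ k) ^ (-s) :=
          Real.rpow_le_rpow_of_nonpos (by positivity) hk1 (by linarith)
      _ = (p : ℝ) ^ (-(s * k)) := by
          rw [← Real.rpow_natCast, ← Real.rpow_mul hpr.le]; ring_nf
  refine lt_of_le_of_lt (lintegral_mono hle) ?_
  rw [lintegral_tsum fun k => (measurable_const.indicator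
    Metric.isClosed_closedBall.measurableSet).aemeasurable]
  have hterm : ∀ k, ∫⁻ x, (B k).indicator (fun _ => b k) x =
      ENNReal.ofReal ((p : ℝ) ^ n * ((p : ℝ) ^ ((n : ℝ) - s)) ^ k) := by
    intro k
    rw [lintegral_indicator Metric.isClosed_closedBall.measurableSet, setLIntegral_const, hB,
      ← ENNReal.ofReal_mul (by positivity)]
    congr 1
    rw [← Real.rpow_natCast _ k, ← Real.rpow_mul hpr.le, ← pow_mul, ← Real.rpow_natCast,
      ← Real.rpow_natCast, ← Real.rpow_add hpr, ← Real.rpow_add hpr]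
    congr 1
    push_cast
    ring
  -- The series is geometric with ratio `p ^ (n - s) < 1`.
  rw [tsum_congr hterm]
  have hq : (p : ℝ) ^ ((n : ℝ) - s) < 1 := Real.rpow_lt_one_of_one_lt_of_neg hp1 (by linarith)
  have hsum : Summable fun k : ℕ => (p : ℝ) ^ n * ((p : ℝ) ^ ((n : ℝ) - s)) ^ k :=
    (summable_geometric_of_lt_one (by positivity) hq).mul_left _
  rw [← ENNReal.ofReal_tsum_of_nonneg (fun k => by positivity) hsum]
  exact ENNReal.ofReal_lt_top

/-! ### Integrals of characters -/

theorem continuous_psi_pairing (x : Fin n → ℚ_[p]) : Continuous fun ξ => psi (pairing x ξ) :=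
  continuous_psi.comp (continuous_pairing.comp (by fun_prop : Continuous fun ξ => (x, ξ)))

theorem integrable_psi_pairing_mul {F : (Fin n → ℚ_[p]) → ℂ} (hF : Integrable F)
    (x : Fin n → ℚ_[p]) : Integrable fun ξ => psi (pairing x ξ) * F ξ :=
  hF.bdd_mul (c := 1) (continuous_psi_pairing x).aestronglyMeasurable (ae_of_all _ fun ξ => by simp)

/-- A function invariant under a translation on which the character `Ψ(x·)` is not trivial is
orthogonal to that character. -/
theorem fourierInv_eq_zero_of_periodic {F : (Fin n → ℚ_[p]) → ℂ} {x h : Fin n → ℚ_[p]}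
    (hF : ∀ ξ, F (ξ + h) = F ξ) (hh : psi (pairing x h) ≠ 1) : fourierInv F x = 0 := by
  have h1 : fourierInv F x = psi (pairing x h) * fourierInv F x := by
    unfold fourierInv
    conv_lhs => rw [← integral_add_right_eq_self _ h]
    rw [← integral_const_mul]
    congr 1
    ext ξ
    rw [pairing_add_right, psi_add, hF]
    ring
  have h2 : (1 - psi (pairing x h)) * fourierInv F x = 0 := by linear_combination h1
  exact (mul_eq_zero.1 h2).resolve_left (sub_ne_zero.2 hh.symm)

theorem norm_add_le_iff_of_norm_le {E : Type*} [SeminormedAddCommGroup E] [IsUltrametricDist E]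
    {ξ h : E} {r : ℝ} (hh : ‖h‖ ≤ r) : ‖ξ + h‖ ≤ r ↔ ‖ξ‖ ≤ r := by
  constructor
  · intro h1
    have : ξ = (ξ + h) + -h := by abel
    rw [this]
    exact (IsUltrametricDist.norm_add_le_max _ _).trans (max_le h1 (by rwa [norm_neg]))
  · intro h1
    exact (IsUltrametricDist.norm_add_le_max _ _).trans (max_le h1 hh)

/-- The character `Ψ(x·)` is not trivial on the ball of radius `‖c‖` as soon as `‖c‖ ‖x‖ > 1`. -/
theorem exists_psi_pairing_ne_one_of_lt {c : ℚ_[p]} (hc : c ≠ 0) {x : Fin n → ℚ_[p]}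
    (hx : ‖c‖⁻¹ < ‖x‖) : ∃ h : Fin n → ℚ_[p], ‖h‖ ≤ ‖c‖ ∧ psi (pairing x h) ≠ 1 := by
  have hcp := norm_pos_iff.2 hc
  have hx0 : x ≠ 0 := norm_pos_iff.1 ((inv_pos.2 hcp).trans hx)
  obtain ⟨i, hi⟩ := exists_norm_apply_eq hx0
  have hxi : x i ≠ 0 := by rw [← norm_ne_zero_iff, hi]; exact norm_ne_zero_iff.2 hx0
  refine ⟨Pi.single i c, (Pi.norm_single _).le, ?_⟩
  have : pairing x (Pi.single i c) = x i * c := by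
    rw [pairing, Finset.sum_eq_single i]
    · rw [Pi.single_eq_same]
    · intro j _ hj; simp [Pi.single_eq_of_ne hj]
    · simp
  rw [this, Ne, psi_eq_one_iff, norm_mul, hi, not_le]
  rwa [inv_lt_iff_one_lt_mul₀ hcp] at hx

theorem fourierInv_indicator_closedBall {c : ℚ_[p]} (hc : c ≠ 0) (x : Fin n → ℚ_[p]) :
    fourierInv ((Metric.closedBall 0 ‖c‖).indicator fun _ => (1 : ℂ)) x =
      (Metric.closedBall (0 : Fin n → ℚ_[p]) ‖c⁻¹‖).indicator (fun _ => ((‖c‖ ^ n : ℝ) : ℂ)) x := by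
  have hcp := norm_pos_iff.2 hc
  by_cases hx : x ∈ Metric.closedBall (0 : Fin n → ℚ_[p]) ‖c⁻¹‖
  · rw [Set.indicator_of_mem hx]
    rw [mem_closedBall_zero_iff, norm_inv] at hx
    have : ∀ ξ, psi (pairing x ξ) * (Metric.closedBall 0 ‖c‖).indicator (fun _ => (1 : ℂ)) ξ =
        (Metric.closedBall 0 ‖c‖).indicator (fun _ => (1 : ℂ)) ξ := by
      intro ξ
      by_cases hξ : ξ ∈ Metric.closedBall (0 : Fin n → ℚ_[p]) ‖c‖
      · rw [psi_eq_one_iff.2, one_mul]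
        rw [mem_closedBall_zero_iff] at hξ
        calc ‖pairing x ξ‖ ≤ ‖x‖ * ‖ξ‖ := norm_pairing_le x ξ
          _ ≤ ‖c‖⁻¹ * ‖c‖ := by gcongr
          _ = 1 := inv_mul_cancel₀ hcp.ne'
      · simp [Set.indicator_of_notMem hξ]
    simp_rw [fourierInv, this]
    rw [integral_indicator Metric.isClosed_closedBall.measurableSet, setIntegral_const,
      measureReal_pi_closedBall_norm hc]
    simp
  · rw [Set.indicator_of_notMem hx]
    rw [mem_closedBall_zero_iff, norm_inv, not_le] at hx
    obtain ⟨h, hh1, hh2⟩ := exists_psi_pairing_ne_one_of_lt hc hx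
    refine fourierInv_eq_zero_of_periodic (h := h) (fun ξ => ?_) hh2
    simp only [Set.indicator, mem_closedBall_zero_iff, norm_add_le_iff_of_norm_le hh1]

theorem fourier_eq_fourierInv_neg (φ : (Fin n → ℚ_[p]) → ℂ) (ξ : Fin n → ℚ_[p]) :
    fourier φ ξ = fourierInv φ (-ξ) := by
  simp only [fourier, fourierInv, pairing_neg_left, pairing_comm _ ξ]

theorem fourierInv_eq_fourier_comp_neg (φ : (Fin n → ℚ_[p]) → ℂ) (ξ : Fin n → ℚ_[p]) :
    fourierInv φ ξ = fourier (fun x => φ (-x)) ξ := by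
  unfold fourier fourierInv
  rw [← integral_neg_eq_self]
  simp [pairing_comm]

theorem norm_fourierInv_le (φ : (Fin n → ℚ_[p]) → ℂ) (x : Fin n → ℚ_[p]) :
    ‖fourierInv φ x‖ ≤ ∫ ξ, ‖φ ξ‖ := by
  refine (norm_integral_le_integral_norm _).trans_eq ?_
  simp

theorem fourierInv_sub {φ ψ : (Fin n → ℚ_[p]) → ℂ} (hφ : Integrable φ) (hψ : Integrable ψ) :
    fourierInv (φ - ψ) = fourierInv φ - fourierInv ψ := by
  ext x
  simp only [fourierInv, Pi.sub_apply, mul_sub]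
  exact integral_sub (integrable_psi_pairing_mul hφ x) (integrable_psi_pairing_mul hψ x)

theorem fourier_sub {φ ψ : (Fin n → ℚ_[p]) → ℂ} (hφ : Integrable φ) (hψ : Integrable ψ) :
    fourier (φ - ψ) = fourier φ - fourier ψ := by
  ext x
  simp [fourier_eq_fourierInv_neg, fourierInv_sub hφ hψ]

theorem continuous_fourierInv {φ : (Fin n → ℚ_[p]) → ℂ} (hφ : Integrable φ) :
    Continuous (fourierInv φ) := by
  refine continuous_of_dominated (bound := fun ξ => ‖φ ξ‖) ?_ ?_ hφ.norm ?_
  · exact fun x => (integrable_psi_pairing_mul hφ x).aestronglyMeasurable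
  · exact fun x => ae_of_all _ fun ξ => by simp
  · refine ae_of_all _ fun ξ => ?_
    simp_rw [pairing_comm _ ξ]
    exact (continuous_psi_pairing ξ).mul continuous_const

/-! ### Fourier analysis of Schwartz--Bruhat functions -/

/-- Schwartz--Bruhat functions are the functions invariant under translation by a ball around `0`
and supported in a ball around `0`. The radii are given as norms of scalars. -/
theorem isSchwartzBruhat_iff {φ : (Fin n → ℚ_[p]) → ℂ} :
    IsSchwartzBruhat φ ↔ ∃ c e : ℚ_[p], c ≠ 0 ∧ e ≠ 0 ∧
      (∀ x h, ‖h‖ ≤ ‖c‖ → φ (x + h) = φ x) ∧ ∀ x, ‖e‖ < ‖x‖ → φ x = 0 := by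
  constructor
  · rintro ⟨hloc, hcs⟩
    obtain ⟨δ, hδ, hδ'⟩ := lebesgue_number_lemma_of_metric (s := tsupport φ) (ι := ℂ)
      (c := fun z => φ ⁻¹' {z}) hcs (fun z => hloc.isOpen_fiber z)
      (fun x _ => Set.mem_iUnion.2 ⟨φ x, rfl⟩)
    have hball : ∀ x ∈ tsupport φ, ∀ y, dist y x < δ → φ y = φ x := by
      intro x hx y hy
      obtain ⟨z, hz⟩ := hδ' x hx
      exact (hz hy : φ y = z).trans (hz (Metric.mem_ball_self hδ) : φ x = z).symm
    obtain ⟨c, hc0, hc⟩ := NormedField.exists_norm_lt ℚ_[p] hδ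
    obtain ⟨R, hR⟩ := hcs.isBounded.exists_norm_le
    obtain ⟨e, he⟩ := NormedField.exists_lt_norm ℚ_[p] (max R 0)
    refine ⟨c, e, norm_pos_iff.1 hc0, norm_pos_iff.1 ((le_max_right R 0).trans_lt he), ?_, ?_⟩
    · intro x h hh
      by_cases hx : x ∈ tsupport φ
      · exact hball x hx _ (by simpa using hh.trans_lt hc)
      · by_cases hxh : x + h ∈ tsupport φ
        · exact (hball _ hxh x (by simpa [dist_eq_norm] using hh.trans_lt hc)).symm
        · rw [image_eq_zero_of_notMem_tsupport hx, image_eq_zero_of_notMem_tsupport hxh]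
    · intro x hx
      refine image_eq_zero_of_notMem_tsupport fun hx' => ?_
      exact absurd ((hR x hx').trans ((le_max_left R 0).trans he.le)) (not_le.2 hx)
  · rintro ⟨c, e, hc, he, h1, h2⟩
    refine ⟨?_, ?_⟩
    · rw [IsLocallyConstant.iff_eventually_eq]
      intro x
      filter_upwards [Metric.ball_mem_nhds x (norm_pos_iff.2 hc)] with y hy
      rw [Metric.mem_ball, dist_eq_norm] at hy
      rw [← h1 x (y - x) hy.le]
      congr 1
      abel
    · refine HasCompactSupport.intro (isCompact_closedBall (0 : Fin n → ℚ_[p]) ‖e‖) fun x hx => ?_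
      exact h2 x (by simpa using hx)

theorem IsSchwartzBruhat.continuous {φ : (Fin n → ℚ_[p]) → ℂ} (hφ : IsSchwartzBruhat φ) :
    Continuous φ := hφ.1.continuous

theorem IsSchwartzBruhat.memLp {φ : (Fin n → ℚ_[p]) → ℂ} (hφ : IsSchwartzBruhat φ)
    (q : ENNReal) : MemLp φ q :=
  hφ.continuous.memLp_of_hasCompactSupport hφ.2

theorem IsSchwartzBruhat.integrable {φ : (Fin n → ℚ_[p]) → ℂ} (hφ : IsSchwartzBruhat φ) :
    Integrable φ := memLp_one_iff_integrable.1 (hφ.memLp 1)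

theorem IsSchwartzBruhat.sub {φ ψ : (Fin n → ℚ_[p]) → ℂ} (hφ : IsSchwartzBruhat φ)
    (hψ : IsSchwartzBruhat ψ) : IsSchwartzBruhat (φ - ψ) :=
  ⟨hφ.1.sub hψ.1, hφ.2.sub hψ.2⟩

theorem IsSchwartzBruhat.comp_neg {φ : (Fin n → ℚ_[p]) → ℂ} (hφ : IsSchwartzBruhat φ) :
    IsSchwartzBruhat fun x => φ (-x) := by
  obtain ⟨c, e, hc, he, h1, h2⟩ := isSchwartzBruhat_iff.1 hφ
  refine isSchwartzBruhat_iff.2 ⟨c, e, hc, he, fun x h hh => ?_, fun x hx => ?_⟩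
  · rw [neg_add]; exact h1 _ _ (by rwa [norm_neg])
  · exact h2 _ (by rwa [norm_neg])

theorem isSchwartzBruhat_indicator_closedBall {c : ℚ_[p]} (hc : c ≠ 0) :
    IsSchwartzBruhat ((Metric.closedBall (0 : Fin n → ℚ_[p]) ‖c‖).indicator fun _ => (1 : ℂ)) := by
  refine isSchwartzBruhat_iff.2 ⟨c, c, hc, hc, fun x h hh => ?_, fun x hx => ?_⟩
  · simp only [Set.indicator, mem_closedBall_zero_iff, norm_add_le_iff_of_norm_le hh]
  · exact Set.indicator_of_notMem (by simpa using hx) _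

/-- The Fourier transform exchanges invariance under a ball and support in the dual ball. -/
theorem IsSchwartzBruhat.fourierInv {φ : (Fin n → ℚ_[p]) → ℂ} (hφ : IsSchwartzBruhat φ) :
    IsSchwartzBruhat (fourierInv φ) := by
  obtain ⟨c, e, hc, he, h1, h2⟩ := isSchwartzBruhat_iff.1 hφ
  refine isSchwartzBruhat_iff.2 ⟨e⁻¹, c⁻¹, inv_ne_zero he, inv_ne_zero hc, fun x h hh => ?_,
    fun x hx => ?_⟩
  · unfold PadicPDE.fourierInv
    congr 1
    ext ξ
    by_cases hξ : ‖ξ‖ ≤ ‖e‖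
    · rw [pairing_add_left, psi_add, psi_eq_one_iff.2 (?_ : ‖pairing h ξ‖ ≤ 1), mul_one]
      rw [norm_inv] at hh
      calc ‖pairing h ξ‖ ≤ ‖h‖ * ‖ξ‖ := norm_pairing_le _ _
        _ ≤ ‖e‖⁻¹ * ‖e‖ := by gcongr
        _ = 1 := inv_mul_cancel₀ (norm_ne_zero_iff.2 he)
    · rw [h2 ξ (not_le.1 hξ), mul_zero, mul_zero]
  · rw [norm_inv] at hx
    obtain ⟨h, hh1, hh2⟩ := exists_psi_pairing_ne_one_of_lt hc hx
    exact fourierInv_eq_zero_of_periodic (fun ξ => h1 ξ h hh1) hh2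

theorem IsSchwartzBruhat.fourier {φ : (Fin n → ℚ_[p]) → ℂ} (hφ : IsSchwartzBruhat φ) :
    IsSchwartzBruhat (fourier φ) := by
  have : PadicPDE.fourier φ = fun ξ => PadicPDE.fourierInv φ (-ξ) :=
    funext (fourier_eq_fourierInv_neg φ)
  rw [this]
  exact hφ.fourierInv.comp_neg

theorem integrable_prod_psi_pairing_mul {F G : (Fin n → ℚ_[p]) → ℂ} (hF : Integrable F)
    (hG : Integrable G) : Integrable
      (fun q : (Fin n → ℚ_[p]) × (Fin n → ℚ_[p]) => psi (pairing q.1 q.2) * (F q.1 * G q.2))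
      (volume.prod volume) :=
  (hF.mul_prod hG).bdd_mul (c := 1) (continuous_psi.comp continuous_pairing).aestronglyMeasurable
    (ae_of_all _ fun q => by simp)

/-- The Fourier transform is its own transpose. -/
theorem integral_fourierInv_mul {F G : (Fin n → ℚ_[p]) → ℂ} (hF : Integrable F)
    (hG : Integrable G) : ∫ x, fourierInv F x * G x = ∫ ξ, F ξ * fourierInv G ξ := by
  have h := integral_integral_swap (μ := volume) (ν := volume)
    (f := fun x ξ => psi (pairing x ξ) * (F x * G ξ)) (integrable_prod_psi_pairing_mul hF hG)
  calc ∫ x, fourierInv F x * G x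
      = ∫ y, ∫ x, psi (pairing x y) * (F x * G y) := by
        congr 1; ext y
        rw [fourierInv, ← integral_mul_const]
        congr 1; ext x
        rw [pairing_comm]; ring
    _ = ∫ x, ∫ y, psi (pairing x y) * (F x * G y) := h.symm
    _ = ∫ ξ, F ξ * fourierInv G ξ := by
        congr 1; ext y
        rw [fourierInv, ← integral_const_mul]
        congr 1; ext x; ring

theorem fourierInv_psi_mul (G : (Fin n → ℚ_[p]) → ℂ) (x y : Fin n → ℚ_[p]) :
    fourierInv (fun ξ => psi (pairing x ξ) * G ξ) y = fourierInv G (x + y) := by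
  unfold fourierInv
  congr 1; ext ξ
  rw [pairing_add_left, psi_add]; ring

/-- For `𝓕 φ` supported in the ball of radius `‖c‖`, the inverse transform of `𝓕 φ` is the mean of
`φ` over balls of radius `‖c‖⁻¹`. -/
theorem IsSchwartzBruhat.fourierInv_fourier {φ : (Fin n → ℚ_[p]) → ℂ} (hφ : IsSchwartzBruhat φ) :
    PadicPDE.fourierInv (PadicPDE.fourier φ) = φ := by
  obtain ⟨c, e, hc, he, h1, h2⟩ := isSchwartzBruhat_iff.1 hφ
  obtain ⟨c', e', hc', he', h1', h2'⟩ := isSchwartzBruhat_iff.1 hφ.fourier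
  -- `𝓕 φ` is supported in the ball of radius `‖b‖`, and `φ` is invariant under the dual ball.
  obtain ⟨b, hb⟩ := NormedField.exists_lt_norm ℚ_[p] (max ‖e'‖ ‖c⁻¹‖)
  have hb1 : ‖e'‖ ≤ ‖b‖ := (le_max_left _ _).trans hb.le
  have hbp : 0 < ‖b‖ := (norm_pos_iff.2 he').trans_le hb1
  have hb0 : b ≠ 0 := norm_pos_iff.1 hbp
  have hb2 : ‖b⁻¹‖ ≤ ‖c‖ := by
    rw [norm_inv]
    refine inv_le_of_inv_le₀ (norm_pos_iff.2 hc) ?_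
    rw [← norm_inv]; exact (le_max_right _ _).trans hb.le
  ext x
  set I : (Fin n → ℚ_[p]) → ℂ := (Metric.closedBall 0 ‖b‖).indicator fun _ => (1 : ℂ) with hI
  have hIint : Integrable I := (isSchwartzBruhat_indicator_closedBall hb0).integrable
  have e1 : PadicPDE.fourierInv (PadicPDE.fourier φ) x =
      ∫ ξ, PadicPDE.fourierInv (fun y => φ (-y)) ξ * (psi (pairing x ξ) * I ξ) := by
    rw [PadicPDE.fourierInv]
    congr 1; ext ξ
    have : PadicPDE.fourierInv (fun y => φ (-y)) ξ = PadicPDE.fourier φ ξ := by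
      rw [fourierInv_eq_fourier_comp_neg]; simp
    rw [this]
    by_cases hξ : ‖ξ‖ ≤ ‖b‖
    · rw [hI, Set.indicator_of_mem (by simpa using hξ)]; ring
    · rw [h2' ξ (hb1.trans_lt (not_le.1 hξ))]; ring
  have e2 : ∀ y, φ (-y) * PadicPDE.fourierInv (fun ξ => psi (pairing x ξ) * I ξ) y =
      φ x * (Metric.closedBall (-x) ‖b⁻¹‖).indicator (fun _ => ((‖b‖ ^ n : ℝ) : ℂ)) y := by
    intro y
    rw [fourierInv_psi_mul, hI, fourierInv_indicator_closedBall hb0]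
    by_cases hy : ‖x + y‖ ≤ ‖b⁻¹‖
    · have : φ (-y) = φ x := by
        rw [← h1 (-y) (x + y) (hy.trans hb2)]; simp
      rw [this, Set.indicator_of_mem (by simpa using hy), Set.indicator_of_mem]
      rwa [Metric.mem_closedBall, dist_eq_norm, sub_neg_eq_add, add_comm]
    · rw [Set.indicator_of_notMem (by simpa using hy), Set.indicator_of_notMem]
      · simp
      rwa [Metric.mem_closedBall, dist_eq_norm, sub_neg_eq_add, add_comm]
  rw [e1, integral_fourierInv_mul hφ.comp_neg.integrable (integrable_psi_pairing_mul hIint x)]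
  simp_rw [e2]
  rw [integral_const_mul, integral_indicator Metric.isClosed_closedBall.measurableSet,
    setIntegral_const, measureReal_def, Measure.addHaar_closedBall_center, ← measureReal_def,
    measureReal_pi_closedBall_norm (inv_ne_zero hb0), norm_inv, Complex.real_smul,
    ← Complex.ofReal_mul, inv_pow, inv_mul_cancel₀ (by positivity)]
  simp

theorem IsSchwartzBruhat.fourier_fourierInv {φ : (Fin n → ℚ_[p]) → ℂ} (hφ : IsSchwartzBruhat φ) :
    PadicPDE.fourier (PadicPDE.fourierInv φ) = φ := by
  ext ξ
  have h : PadicPDE.fourierInv φ = PadicPDE.fourier fun x => φ (-x) :=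
    funext (fourierInv_eq_fourier_comp_neg φ)
  rw [fourier_eq_fourierInv_neg, h, hφ.comp_neg.fourierInv_fourier]
  simp

/-- Plancherel's theorem for Schwartz--Bruhat functions. -/
theorem IsSchwartzBruhat.integral_norm_fourierInv_sq {φ : (Fin n → ℚ_[p]) → ℂ}
    (hφ : IsSchwartzBruhat φ) :
    ∫ x, ‖PadicPDE.fourierInv φ x‖ ^ 2 = ∫ x, ‖φ x‖ ^ 2 := by
  have hconj : ∀ ξ, PadicPDE.fourierInv (fun x => (starRingEnd ℂ) (PadicPDE.fourierInv φ x)) ξ =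
      (starRingEnd ℂ) (φ ξ) := by
    intro ξ
    conv_rhs => rw [← hφ.fourier_fourierInv]
    rw [PadicPDE.fourierInv, PadicPDE.fourier, ← integral_conj]
    congr 1; ext x
    rw [map_mul, psi_neg, Complex.conj_conj, pairing_comm]
  have h := integral_fourierInv_mul hφ.integrable
    (G := fun x => (starRingEnd ℂ) (PadicPDE.fourierInv φ x))
    ((LinearIsometryEquiv.integrable_comp_iff Complex.conjLIE).2 hφ.fourierInv.integrable)
  simp_rw [hconj, Complex.mul_conj, Complex.normSq_eq_norm_sq] at h
  rw [integral_complex_ofReal, integral_complex_ofReal] at h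
  exact_mod_cast h

theorem IsSchwartzBruhat.eLpNorm_fourierInv {φ : (Fin n → ℚ_[p]) → ℂ} (hφ : IsSchwartzBruhat φ) :
    eLpNorm (PadicPDE.fourierInv φ) 2 volume = eLpNorm φ 2 volume := by
  rw [MemLp.eLpNorm_eq_integral_rpow_norm two_ne_zero ENNReal.ofNat_ne_top (hφ.memLp 2),
    MemLp.eLpNorm_eq_integral_rpow_norm two_ne_zero ENNReal.ofNat_ne_top (hφ.fourierInv.memLp 2)]
  simp [hφ.integral_norm_fourierInv_sq]

theorem IsSchwartzBruhat.eLpNorm_fourier {φ : (Fin n → ℚ_[p]) → ℂ} (hφ : IsSchwartzBruhat φ) :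
    eLpNorm (PadicPDE.fourier φ) 2 volume = eLpNorm φ 2 volume := by
  rw [← hφ.fourier.eLpNorm_fourierInv, hφ.fourierInv_fourier]

/-! ### The Fourier transform on `L²` -/

theorem ennreal_squeeze_zero {f g : ℕ → ENNReal} (hfg : ∀ k, f k ≤ g k)
    (hg : Tendsto g atTop (𝓝 0)) : Tendsto f atTop (𝓝 0) :=
  tendsto_of_tendsto_of_tendsto_of_le_of_le tendsto_const_nhds hg (fun _ => zero_le) hfg

theorem memLp_mul_of_bdd {m Φ : (Fin n → ℚ_[p]) → ℂ} {C : ℝ} (hm : AEStronglyMeasurable m volume)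
    (hmC : ∀ ξ, ‖m ξ‖ ≤ C) (hΦ : MemLp Φ 2) : MemLp (m * Φ) 2 := by
  refine hΦ.of_le_mul (c := C) (hm.mul hΦ.1) (ae_of_all _ fun ξ => ?_)
  rw [Pi.mul_apply, norm_mul]
  exact mul_le_mul_of_nonneg_right (hmC ξ) (norm_nonneg _)

/-- A uniformly continuous function is uniformly close to one that is constant on the cosets of a
small ball: evaluate it at a chosen representative of each coset. -/
theorem exists_isSchwartzBruhat_dist_le {g : (Fin n → ℚ_[p]) → ℂ} (hg : Continuous g)
    (hgc : HasCompactSupport g) : ∃ R : ℝ, ∀ ε : ℝ, 0 < ε → ∃ φ, IsSchwartzBruhat φ ∧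
      (∀ x, dist (φ x) (g x) ≤ ε) ∧ φ.support ⊆ Metric.closedBall 0 R ∧
        g.support ⊆ Metric.closedBall 0 R := by
  obtain ⟨R, hR⟩ := hgc.isBounded.exists_norm_le
  obtain ⟨e, he⟩ := NormedField.exists_lt_norm ℚ_[p] (max R 0)
  have he0 : 0 < ‖e‖ := (le_max_right R 0).trans_lt he
  have hgs : ∀ x, ‖e‖ < ‖x‖ → g x = 0 := by
    intro x hx
    refine image_eq_zero_of_notMem_tsupport fun hx' => ?_
    exact absurd ((hR x hx').trans ((le_max_left R 0).trans he.le)) (not_le.2 hx)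
  refine ⟨‖e‖, fun ε hε => ?_⟩
  obtain ⟨δ, hδ, hδ'⟩ := Metric.uniformContinuous_iff.1
    (hgc.uniformContinuous_of_continuous hg) ε hε
  obtain ⟨c, hc0, hc⟩ := NormedField.exists_norm_lt ℚ_[p] (lt_min hδ he0)
  let s : Setoid (Fin n → ℚ_[p]) :=
    { r := fun x y => ‖x - y‖ ≤ ‖c‖
      iseqv :=
        { refl := fun x => by simp
          symm := fun {x y} h => by rwa [norm_sub_rev]
          trans := fun {x y z} h1 h2 => by
            rw [← sub_add_sub_cancel x y z]
            exact (IsUltrametricDist.norm_add_le_max _ _).trans (max_le h1 h2) } }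
  let r : (Fin n → ℚ_[p]) → (Fin n → ℚ_[p]) := fun x => Quotient.out (Quotient.mk s x)
  have hr : ∀ x, ‖r x - x‖ ≤ ‖c‖ := fun x => Quotient.mk_out (s := s) x
  have hφs : ∀ x, ‖e‖ < ‖x‖ → g (r x) = 0 := by
    refine fun x hx => hgs _ (lt_of_not_ge fun h => not_le.2 hx ?_)
    have : x = r x + -(r x - x) := by abel
    rw [this]
    refine (IsUltrametricDist.norm_add_le_max _ _).trans (max_le h ?_)
    rw [norm_neg]
    exact (hr x).trans (hc.le.trans (min_le_right _ _))
  refine ⟨fun x => g (r x), isSchwartzBruhat_iff.2 ⟨c, e, norm_pos_iff.1 hc0, norm_pos_iff.1 he0,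
    fun x h hh => ?_, hφs⟩, fun x => ?_, fun x hx => ?_, fun x hx => ?_⟩
  · have : Quotient.mk s (x + h) = Quotient.mk s x :=
      Quotient.sound (show ‖x + h - x‖ ≤ ‖c‖ by simpa using hh)
    simp only [r, this]
  · refine (hδ' ?_).le
    rw [dist_eq_norm]
    exact (hr x).trans_lt (hc.trans_le (min_le_left _ _))
  · rw [mem_closedBall_zero_iff]
    by_contra h
    exact hx (hφs x (not_le.1 h))
  · rw [mem_closedBall_zero_iff]
    by_contra h
    exact hx (hgs x (not_le.1 h))

theorem exists_isSchwartzBruhat_eLpNorm_sub_le {g : (Fin n → ℚ_[p]) → ℂ} (hg : MemLp g 2)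
    {ε : ENNReal} (hε : ε ≠ 0) : ∃ φ, IsSchwartzBruhat φ ∧ eLpNorm (φ - g) 2 volume ≤ ε := by
  have hε2 : ε / 2 ≠ 0 := by simpa using hε
  obtain ⟨g', hg'c, hg', hg'cont, hg'm⟩ :=
    hg.exists_hasCompactSupport_eLpNorm_sub_le ENNReal.ofNat_ne_top hε2
  obtain ⟨R, hR⟩ := exists_isSchwartzBruhat_dist_le hg'cont hg'c
  set V : ENNReal := volume (Metric.closedBall (0 : Fin n → ℚ_[p]) R) ^ (1 / (2 : ENNReal).toReal)
  have hV : V ≠ ⊤ :=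
    ENNReal.rpow_ne_top_of_nonneg (by simp) (isCompact_closedBall _ _).measure_lt_top.ne
  have hlim : Tendsto (fun η : ℝ => ENNReal.ofReal η * V) (𝓝[>] 0) (𝓝 0) := by
    have h1 : Tendsto (fun η : ℝ => ENNReal.ofReal η) (𝓝[>] 0) (𝓝 (ENNReal.ofReal 0)) :=
      ENNReal.continuous_ofReal.continuousAt.tendsto.mono_left nhdsWithin_le_nhds
    have := ENNReal.Tendsto.mul_const h1 (Or.inr hV)
    simpa using this
  obtain ⟨η, hη1, hη2⟩ := ((hlim.eventually_le_const
    (pos_iff_ne_zero.2 hε2)).and self_mem_nhdsWithin).exists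
  obtain ⟨φ, hφ, hφd, hφs, hgs⟩ := hR η hη2
  refine ⟨φ, hφ, ?_⟩
  have h1 : eLpNorm (φ - g') 2 volume ≤ ε / 2 :=
    (eLpNorm_sub_le_of_dist_bdd volume ENNReal.ofNat_ne_top
      Metric.isClosed_closedBall.measurableSet (le_of_lt hη2) hφd hφs hgs).trans hη1
  have h2 : eLpNorm (g' - g) 2 volume ≤ ε / 2 := by rwa [eLpNorm_sub_comm]
  calc eLpNorm (φ - g) 2 volume = eLpNorm ((φ - g') + (g' - g)) 2 volume := by
        rw [sub_add_sub_cancel]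
    _ ≤ eLpNorm (φ - g') 2 volume + eLpNorm (g' - g) 2 volume :=
        eLpNorm_add_le ((hφ.memLp 2).sub hg'm).1 (hg'm.sub hg).1 one_le_two
    _ ≤ ε / 2 + ε / 2 := add_le_add h1 h2
    _ = ε := ENNReal.add_halves ε

theorem exists_seq_isSchwartzBruhat_tendsto {g : (Fin n → ℚ_[p]) → ℂ} (hg : MemLp g 2) :
    ∃ φ : ℕ → (Fin n → ℚ_[p]) → ℂ, (∀ k, IsSchwartzBruhat (φ k)) ∧
      ∀ k, eLpNorm (φ k - g) 2 volume ≤ (2⁻¹ : ENNReal) ^ k := by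
  have : ∀ k : ℕ, ∃ φ, IsSchwartzBruhat φ ∧ eLpNorm (φ - g) 2 volume ≤ (2⁻¹ : ENNReal) ^ k :=
    fun k => exists_isSchwartzBruhat_eLpNorm_sub_le hg (by simp)
  choose φ hφ hφ' using this
  exact ⟨φ, hφ, hφ'⟩

theorem tendsto_two_inv_pow : Tendsto (fun k : ℕ => (2⁻¹ : ENNReal) ^ k) atTop (𝓝 0) :=
  ENNReal.tendsto_pow_atTop_nhds_zero_of_lt_one (by simp)

/-- The Fourier transform extends to `L²` by Plancherel's theorem and completeness. -/
theorem exists_isL2Fourier {g : (Fin n → ℚ_[p]) → ℂ} (hg : MemLp g 2) :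
    ∃ G, IsL2Fourier g G := by
  obtain ⟨φ, hφ, hφ'⟩ := exists_seq_isSchwartzBruhat_tendsto hg
  -- The constant is `3` and not `2` because the Cauchy estimate has to be strict.
  let B : ℕ → ENNReal := fun N => 3 * (2⁻¹ : ENNReal) ^ N
  have hB : ∑' N, B N ≠ ⊤ := by
    rw [ENNReal.tsum_mul_left, ENNReal.tsum_geometric]
    exact ENNReal.mul_ne_top (by simp) (by simp)
  have hcau : ∀ N k l : ℕ, N ≤ k → N ≤ l →
      eLpNorm (fourier (φ k) - fourier (φ l)) 2 volume < B N := by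
    intro N k l hk hl
    rw [← fourier_sub (hφ k).integrable (hφ l).integrable, ((hφ k).sub (hφ l)).eLpNorm_fourier]
    have hmono : ∀ j, N ≤ j → eLpNorm (φ j - g) 2 volume ≤ (2⁻¹ : ENNReal) ^ N := fun j hj =>
      (hφ' j).trans (pow_le_pow_right_of_le_one' (by simp) hj)
    calc eLpNorm (φ k - φ l) 2 volume = eLpNorm ((φ k - g) + (g - φ l)) 2 volume := by
          rw [sub_add_sub_cancel]
      _ ≤ eLpNorm (φ k - g) 2 volume + eLpNorm (g - φ l) 2 volume :=
          eLpNorm_add_le (((hφ k).memLp 2).sub hg).1 (hg.sub ((hφ l).memLp 2)).1 one_le_two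
      _ ≤ (2⁻¹ : ENNReal) ^ N + (2⁻¹ : ENNReal) ^ N :=
          add_le_add (hmono k hk) (by rw [eLpNorm_sub_comm]; exact hmono l hl)
      _ = 2 * (2⁻¹ : ENNReal) ^ N := (two_mul _).symm
      _ < B N := by
          refine ENNReal.mul_lt_mul_left (by simp) (by finiteness) ?_
          norm_num
  obtain ⟨G, hG, hGlim⟩ := Lp.cauchy_complete_eLpNorm one_le_two
    (fun k => (hφ k).fourier.memLp 2) hB hcau
  exact ⟨G, hg, hG, φ, hφ, ennreal_squeeze_zero hφ' tendsto_two_inv_pow, hGlim⟩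

/-- Cauchy--Schwarz: the integral of a product is continuous in `L²`. -/
theorem tendsto_integral_mul_of_tendsto_eLpNorm {a f : (Fin n → ℚ_[p]) → ℂ}
    {F : ℕ → (Fin n → ℚ_[p]) → ℂ} (ha : MemLp a 2) (hf : MemLp f 2) (hF : ∀ k, MemLp (F k) 2)
    (h : Tendsto (fun k => eLpNorm (F k - f) 2 volume) atTop (𝓝 0)) :
    Tendsto (fun k => ∫ x, a x * F k x) atTop (𝓝 (∫ x, a x * f x)) := by
  refine tendsto_integral_of_L1' (fun x => a x * f x) (ha.integrable_mul hf).1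
    (Eventually.of_forall fun k => ha.integrable_mul (hF k)) ?_
  have hb : ∀ k, eLpNorm ((fun x => a x * F k x) - fun x => a x * f x) 1 volume ≤
      eLpNorm a 2 volume * eLpNorm (F k - f) 2 volume := by
    intro k
    have : ((fun x => a x * F k x) - fun x => a x * f x) = a • (F k - f) := by
      ext x; simp [mul_sub]
    rw [this]
    exact eLpNorm_smul_le_mul_eLpNorm ((hF k).sub hf).1 ha.1
  refine ennreal_squeeze_zero hb ?_
  simpa using ENNReal.Tendsto.const_mul h (Or.inr ha.2.ne)

theorem tendsto_eLpNorm_mul {m Φ : (Fin n → ℚ_[p]) → ℂ} {χ : ℕ → (Fin n → ℚ_[p]) → ℂ} {C : ℝ}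
    (hm : ∀ ξ, ‖m ξ‖ ≤ C) (h : Tendsto (fun k => eLpNorm (χ k - Φ) 2 volume) atTop (𝓝 0)) :
    Tendsto (fun k => eLpNorm (m * χ k - m * Φ) 2 volume) atTop (𝓝 0) := by
  have hb : ∀ k, eLpNorm (m * χ k - m * Φ) 2 volume ≤
      ENNReal.ofReal C * eLpNorm (χ k - Φ) 2 volume := by
    refine fun k => eLpNorm_le_mul_eLpNorm_of_ae_le_mul (ae_of_all _ fun ξ => ?_) 2
    rw [← mul_sub, Pi.mul_apply, norm_mul]
    exact mul_le_mul_of_nonneg_right (hm ξ) (norm_nonneg _)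
  refine ennreal_squeeze_zero hb ?_
  simpa using ENNReal.Tendsto.const_mul h (Or.inr ENNReal.ofReal_ne_top)

/-- The Schwartz--Bruhat functions that vanish near `0` are dense in `L²`. -/
theorem exists_seq_isSchwartzBruhat_eventually_zero {Φ : (Fin n → ℚ_[p]) → ℂ} (hn : n ≠ 0)
    (hΦ : MemLp Φ 2) : ∃ χ : ℕ → (Fin n → ℚ_[p]) → ℂ, (∀ k, IsSchwartzBruhat (χ k)) ∧
      (∀ k, χ k =ᶠ[𝓝 0] 0) ∧ Tendsto (fun k => eLpNorm (χ k - Φ) 2 volume) atTop (𝓝 0) := by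
  obtain ⟨φ, hφ, hφ'⟩ := exists_seq_isSchwartzBruhat_tendsto hΦ
  have hq0 : ∀ k : ℕ, (p : ℚ_[p]) ^ k ≠ 0 := fun k => pow_ne_zero k natCast_prime_ne_zero
  let A : ℕ → Set (Fin n → ℚ_[p]) := fun k => Metric.closedBall 0 ‖(p : ℚ_[p]) ^ k‖
  have hA : ∀ k, MeasurableSet (A k) := fun k => Metric.isClosed_closedBall.measurableSet
  have hAcl : ∀ k, IsClopen (A k) := fun k =>
    IsUltrametricDist.isClopen_closedBall 0 (norm_ne_zero_iff.2 (hq0 k))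
  have hvol : Tendsto (fun k => volume (A k)) atTop (𝓝 0) := by
    have : ∀ k, volume (A k) = ENNReal.ofReal (((p : ℝ)⁻¹ ^ n) ^ k) := fun k => by
      rw [volume_pi_closedBall_norm (hq0 k), norm_pow, Padic.norm_p]
      congr 1; ring
    simp_rw [this]
    rw [← ENNReal.ofReal_zero]
    refine (ENNReal.continuous_ofReal.tendsto 0).comp ?_
    refine tendsto_pow_atTop_nhds_zero_of_lt_one (by positivity) ?_
    exact pow_lt_one₀ (by positivity) (inv_lt_one_of_one_lt₀ (one_lt_natCast_prime p)) hn
  refine ⟨fun k => (A k)ᶜ.indicator (φ k), fun k => ⟨?_, ?_⟩, fun k => ?_, ?_⟩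
  · exact ((⟨φ k, (hφ k).1⟩ : LocallyConstant _ ℂ).indicator (hAcl k).compl).isLocallyConstant
  · exact (hφ k).2.mono (by simp [Set.support_indicator])
  · filter_upwards [(hAcl k).isOpen.mem_nhds (by simp [A])] with ξ hξ
    exact Set.indicator_of_notMem (by simpa using hξ) _
  · have hind : Tendsto (fun k => eLpNorm ((A k).indicator Φ) 2 volume) atTop (𝓝 0) := by
      rw [ENNReal.tendsto_nhds_zero]
      intro ε hε
      obtain ⟨ε', hε'0, hε'⟩ := ENNReal.lt_iff_exists_nnreal_btwn.1 hε
      obtain ⟨δ, hδ, hδ'⟩ := hΦ.eLpNorm_indicator_le one_le_two ENNReal.ofNat_ne_top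
        (ε := ε') (by exact_mod_cast hε'0)
      filter_upwards [hvol.eventually_le_const (ENNReal.ofReal_pos.2 hδ)] with k hk
      refine (hδ' _ (hA k) hk).trans ?_
      rw [ENNReal.ofReal_coe_nnreal]
      exact hε'.le
    have hsum := (tendsto_two_inv_pow.add hind)
    rw [add_zero] at hsum
    refine ennreal_squeeze_zero (fun k => ?_) hsum
    have hsplit : (A k)ᶜ.indicator (φ k) - Φ =
        (A k)ᶜ.indicator (φ k - Φ) - (A k).indicator Φ := by
      ext ξ
      by_cases hξ : ξ ∈ A k <;> simp [hξ]
    rw [hsplit]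
    refine (eLpNorm_sub_le ((((hφ k).memLp 2).sub hΦ).indicator (hA k).compl).1
      (hΦ.indicator (hA k)).1 one_le_two).trans ?_
    exact add_le_add ((eLpNorm_indicator_le _).trans (hφ' k)) le_rfl

/-- The values of `m` near `0` do not matter, as `χ` vanishes there. -/
theorem IsSchwartzBruhat.mul_of_locallyConstant_off_zero {m χ : (Fin n → ℚ_[p]) → ℂ}
    (hm : ∀ ξ, ξ ≠ 0 → ∀ᶠ η in 𝓝 ξ, m η = m ξ) (hχ : IsSchwartzBruhat χ) (hχ0 : χ =ᶠ[𝓝 0] 0) :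
    IsSchwartzBruhat (m * χ) := by
  refine ⟨?_, hχ.2.mul_left⟩
  rw [IsLocallyConstant.iff_eventually_eq]
  intro ξ
  by_cases hξ : ξ = 0
  · subst hξ
    filter_upwards [hχ0] with η hη
    rw [Pi.mul_apply, Pi.mul_apply, hη, hχ0.self_of_nhds]
    simp
  · filter_upwards [hm ξ hξ, (IsLocallyConstant.iff_eventually_eq χ).1 hχ.1 ξ] with η h1 h2
    rw [Pi.mul_apply, Pi.mul_apply, h1, h2]

/-- If inverse transforms `fourierInv (ψ k)` converge pointwise and the `ψ k` converge in `L²`, the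
two limits are Fourier transforms of each other: by Plancherel's theorem the `fourierInv (ψ k)` are
Cauchy in `L²`, and by Fatou's lemma they converge there to their pointwise limit. -/
theorem isL2Fourier_of_tendsto {ψ : ℕ → (Fin n → ℚ_[p]) → ℂ} {v V : (Fin n → ℚ_[p]) → ℂ}
    (hψ : ∀ k, IsSchwartzBruhat (ψ k)) (hV : MemLp V 2) (hv : Continuous v)
    (h : Tendsto (fun k => eLpNorm (ψ k - V) 2 volume) atTop (𝓝 0))
    (hpt : ∀ x, Tendsto (fun k => fourierInv (ψ k) x) atTop (𝓝 (v x))) :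
    IsL2Fourier v V ∧ Tendsto (fun k => eLpNorm (fourierInv (ψ k) - v) 2 volume) atTop (𝓝 0) := by
  have hle : ∀ k, eLpNorm (fourierInv (ψ k) - v) 2 volume ≤ eLpNorm (ψ k - V) 2 volume := by
    intro k
    have h1 : eLpNorm (fourierInv (ψ k) - v) 2 volume ≤
        atTop.liminf fun l => eLpNorm (fourierInv (ψ k) - fourierInv (ψ l)) 2 volume :=
      Lp.eLpNorm_lim_le_liminf_eLpNorm
        (fun l => ((hψ k).fourierInv.continuous.sub
          (hψ l).fourierInv.continuous).aestronglyMeasurable)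
        _ (ae_of_all _ fun x => (tendsto_const_nhds (x := fourierInv (ψ k) x)).sub (hpt x))
    have h2 : ∀ l, eLpNorm (fourierInv (ψ k) - fourierInv (ψ l)) 2 volume ≤
        eLpNorm (ψ k - V) 2 volume + eLpNorm (ψ l - V) 2 volume := by
      intro l
      rw [← fourierInv_sub (hψ k).integrable (hψ l).integrable,
        ((hψ k).sub (hψ l)).eLpNorm_fourierInv, ← sub_sub_sub_cancel_right _ _ V]
      exact eLpNorm_sub_le (((hψ k).memLp 2).sub hV).1 (((hψ l).memLp 2).sub hV).1 one_le_two
    have h3 := (tendsto_const_nhds (x := eLpNorm (ψ k - V) 2 volume)).add h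
    rw [add_zero] at h3
    calc _ ≤ _ := h1
      _ ≤ _ := liminf_le_liminf (Eventually.of_forall h2)
      _ = _ := h3.liminf_eq
  have hlim : Tendsto (fun k => eLpNorm (fourierInv (ψ k) - v) 2 volume) atTop (𝓝 0) :=
    ennreal_squeeze_zero hle h
  have hvm : MemLp v 2 := by
    have : v = fourierInv (ψ 0) - (fourierInv (ψ 0) - v) := by abel
    rw [this]
    refine ((hψ 0).fourierInv.memLp 2).sub
      ⟨((hψ 0).fourierInv.continuous.sub hv).aestronglyMeasurable, (hle 0).trans_lt ?_⟩
    exact (((hψ 0).memLp 2).sub hV).2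
  refine ⟨⟨hvm, hV, fun k => fourierInv (ψ k), fun k => (hψ k).fourierInv, hlim, ?_⟩, hlim⟩
  simpa only [(hψ _).fourier_fourierInv] using h

/-- The inverse transform of a bounded square-integrable multiplier times an `L²` function `Φ`, for
a sequence `χ` of Schwartz--Bruhat functions tending to `Φ` and vanishing near `0`, where the
multiplier need not be locally constant. -/
theorem isL2Fourier_fourierInv_mul {m Φ : (Fin n → ℚ_[p]) → ℂ} {χ : ℕ → (Fin n → ℚ_[p]) → ℂ}
    {C : ℝ} (hm : ∀ ξ, ξ ≠ 0 → ∀ᶠ η in 𝓝 ξ, m η = m ξ) (hmC : ∀ ξ, ‖m ξ‖ ≤ C) (hm2 : MemLp m 2)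
    (hΦ : MemLp Φ 2) (hχ : ∀ k, IsSchwartzBruhat (χ k)) (hχ0 : ∀ k, χ k =ᶠ[𝓝 0] 0)
    (hlim : Tendsto (fun k => eLpNorm (χ k - Φ) 2 volume) atTop (𝓝 0)) :
    IsL2Fourier (fourierInv (m * Φ)) (m * Φ) ∧
      Tendsto (fun k => eLpNorm (fourierInv (m * χ k) - fourierInv (m * Φ)) 2 volume) atTop
        (𝓝 0) := by
  refine isL2Fourier_of_tendsto (ψ := fun k => m * χ k)
    (fun k => (hχ k).mul_of_locallyConstant_off_zero hm (hχ0 k))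
    (memLp_mul_of_bdd hm2.1 hmC hΦ)
    (continuous_fourierInv (hm2.integrable_mul hΦ)) (tendsto_eLpNorm_mul hmC hlim) fun x => ?_
  have hpm : MemLp (fun ξ => psi (pairing x ξ) * m ξ) 2 :=
    
    memLp_mul_of_bdd (C := 1) (continuous_psi_pairing x).aestronglyMeasurable (fun ξ => by simp) hm2
  simpa only [fourierInv, Pi.mul_apply, mul_assoc] using
    tendsto_integral_mul_of_tendsto_eLpNorm hpm hΦ (fun k => (hχ k).memLp 2) hlim

/-! ### Homogeneous symbols -/

/-- The properties of the symbol `a = |f|_p^α` of an elliptic operator that the theory of the heat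
equation needs: `a` is homogeneous of degree `γ > 0`, comparable with `‖ξ‖ ^ γ`, and constant on a
ball around each `ξ ≠ 0` whose radius is proportional to `‖ξ‖`. -/
structure IsHomogeneousSymbol (a : (Fin n → ℚ_[p]) → ℝ) (γ : ℝ) : Prop where
  degree_pos : 0 < γ
  continuous : Continuous a
  lower_bound : ∃ c : ℝ, 0 < c ∧ ∀ ξ, c * ‖ξ‖ ^ γ ≤ a ξ
  upper_bound : ∃ C : ℝ, 0 < C ∧ ∀ ξ, a ξ ≤ C * ‖ξ‖ ^ γ
  locally_constant : ∃ ε : ℝ, 0 < ε ∧ ε ≤ 1 ∧ ∀ ξ h, ‖h‖ ≤ ε * ‖ξ‖ → a (ξ + h) = a ξ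
  homogeneous : ∀ c : ℚ_[p], c ≠ 0 → ∀ ξ, a (c • ξ) = ‖c‖ ^ γ * a ξ

theorem exists_eq_smul_norm_one {ξ : Fin n → ℚ_[p]} (hξ : ξ ≠ 0) :
    ∃ (c : ℚ_[p]) (η : Fin n → ℚ_[p]), c ≠ 0 ∧ ‖c‖ = ‖ξ‖ ∧ ‖η‖ = 1 ∧ ξ = c • η := by
  obtain ⟨i, hi⟩ := exists_norm_apply_eq hξ
  have hξi : ξ i ≠ 0 := by rw [← norm_ne_zero_iff, hi]; exact norm_ne_zero_iff.2 hξ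
  refine ⟨ξ i, (ξ i)⁻¹ • ξ, hξi, hi, ?_, (smul_inv_smul₀ hξi ξ).symm⟩
  rw [norm_smul, norm_inv, hi, inv_mul_cancel₀ (norm_ne_zero_iff.2 hξ)]

theorem IsElliptic.eval_smul {f : MvPolynomial (Fin n) ℚ_[p]} {d : ℕ} (hf : IsElliptic f d)
    {c : ℚ_[p]} (hc : c ≠ 0) (ξ : Fin n → ℚ_[p]) :
    MvPolynomial.eval (c • ξ) f = c ^ d * MvPolynomial.eval ξ f := by
  rw [← hf.homogeneous c hc ξ]
  simp only [pow_one]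
  rfl

theorem IsElliptic.dim_ne_zero {f : MvPolynomial (Fin n) ℚ_[p]} {d : ℕ} (hf : IsElliptic f d) :
    n ≠ 0 := by
  rintro rfl
  exact hf.nonconstant _ (MvPolynomial.eq_C_of_isEmpty f)

theorem IsElliptic.degree_ne_zero {f : MvPolynomial (Fin n) ℚ_[p]} {d : ℕ} (hf : IsElliptic f d) :
    d ≠ 0 := by
  rintro rfl
  have hn := hf.dim_ne_zero
  let ξ : Fin n → ℚ_[p] := fun _ => 1
  have hξ : ξ ≠ 0 := fun h => one_ne_zero (congrFun h ⟨0, Nat.pos_of_ne_zero hn⟩)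
  -- `f` is constant along the sequence `p ^ k • ξ`, which tends to `0`.
  have h1 : Tendsto (fun k : ℕ => MvPolynomial.eval ((p : ℚ_[p]) ^ k • ξ) f) atTop
      (𝓝 (MvPolynomial.eval ((0 : ℚ_[p]) • ξ) f)) := by
    refine ((MvPolynomial.continuous_eval f).tendsto _).comp (Tendsto.smul_const ?_ ξ)
    refine tendsto_pow_atTop_nhds_zero_of_norm_lt_one ?_
    rw [Padic.norm_p]
    exact inv_lt_one_of_one_lt₀ (one_lt_natCast_prime p)
  have h2 : ∀ k : ℕ, MvPolynomial.eval ((p : ℚ_[p]) ^ k • ξ) f = MvPolynomial.eval ξ f := by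
    intro k
    rw [hf.eval_smul (pow_ne_zero k natCast_prime_ne_zero), pow_zero, one_mul]
  simp_rw [h2, zero_smul, (hf.eval_eq_zero_iff 0).2 rfl] at h1
  exact hξ ((hf.eval_eq_zero_iff ξ).1 (tendsto_nhds_unique tendsto_const_nhds h1))

/-- By homogeneity, all the estimates follow from compactness of the unit sphere. -/
theorem IsElliptic.isHomogeneousSymbol {f : MvPolynomial (Fin n) ℚ_[p]} {d : ℕ}
    (hf : IsElliptic f d) {α : ℝ} (hα : 0 < α) : IsHomogeneousSymbol (symbol f α) (d * α) := by
  have hd : (0 : ℝ) < d := by exact_mod_cast Nat.pos_of_ne_zero hf.degree_ne_zero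
  have hγ : 0 < d * α := mul_pos hd hα
  have hcont : Continuous fun ξ => MvPolynomial.eval ξ f := MvPolynomial.continuous_eval f
  have hne : (Metric.sphere (0 : Fin n → ℚ_[p]) 1).Nonempty :=
    ⟨Pi.single ⟨0, Nat.pos_of_ne_zero hf.dim_ne_zero⟩ 1, by simp [Pi.norm_single]⟩
  have hcompact := isCompact_sphere (0 : Fin n → ℚ_[p]) 1
  obtain ⟨ξ₀, hξ₀, hmin⟩ := hcompact.exists_isMinOn hne hcont.norm.continuousOn
  obtain ⟨ξ₁, hξ₁, hmax⟩ := hcompact.exists_isMaxOn hne hcont.norm.continuousOn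
  have hpos : ∀ ξ : Fin n → ℚ_[p], ‖ξ‖ = 1 → 0 < ‖MvPolynomial.eval ξ f‖ := by
    intro ξ hξ
    rw [norm_pos_iff, Ne, hf.eval_eq_zero_iff]
    rintro rfl
    simp at hξ
  have hδ : 0 < ‖MvPolynomial.eval ξ₀ f‖ := hpos ξ₀ (by simpa using hξ₀)
  have hδ₁ : 0 < ‖MvPolynomial.eval ξ₁ f‖ := hpos ξ₁ (by simpa using hξ₁)
  have hpow : ∀ r : ℝ, 0 ≤ r → (r ^ d) ^ α = r ^ (d * α) := fun r hr => by
    rw [Real.rpow_mul hr, Real.rpow_natCast]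
  have hhom : ∀ c : ℚ_[p], c ≠ 0 → ∀ ξ, symbol f α (c • ξ) = ‖c‖ ^ (d * α) * symbol f α ξ := by
    intro c hc ξ
    rw [symbol, symbol, hf.eval_smul hc, norm_mul, norm_pow, Real.mul_rpow (by positivity)
      (by positivity), hpow _ (norm_nonneg c)]
  have hzero : symbol f α (0 : Fin n → ℚ_[p]) = 0 := by
    rw [symbol, (hf.eval_eq_zero_iff 0).2 rfl, norm_zero, Real.zero_rpow hα.ne']
  refine ⟨hγ, hcont.norm.rpow_const fun _ => Or.inr hα.le,
    ⟨_, Real.rpow_pos_of_pos hδ α, fun ξ => ?_⟩, ⟨_, Real.rpow_pos_of_pos hδ₁ α, fun ξ => ?_⟩,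
    ?_, hhom⟩
  · by_cases hξ : ξ = 0
    · rw [hξ, hzero, norm_zero, Real.zero_rpow hγ.ne', mul_zero]
    obtain ⟨c, η, hc, hcξ, hη, rfl⟩ := exists_eq_smul_norm_one hξ
    rw [hhom c hc, ← hcξ, mul_comm]
    refine mul_le_mul_of_nonneg_left ?_ (by positivity)
    exact Real.rpow_le_rpow hδ.le (hmin (by simpa using hη)) hα.le
  · by_cases hξ : ξ = 0
    · rw [hξ, hzero, norm_zero, Real.zero_rpow hγ.ne', mul_zero]
    obtain ⟨c, η, hc, hcξ, hη, rfl⟩ := exists_eq_smul_norm_one hξ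
    rw [hhom c hc, ← hcξ, mul_comm]
    refine mul_le_mul_of_nonneg_right ?_ (by positivity)
    exact Real.rpow_le_rpow (norm_nonneg _) (hmax (by simpa using hη)) hα.le
  · obtain ⟨ε, hε, hε'⟩ := Metric.uniformContinuousOn_iff.1
      ((isCompact_closedBall (0 : Fin n → ℚ_[p]) 1).uniformContinuousOn_of_continuous
        hcont.continuousOn) _ hδ
    have hε2 : (min (ε / 2) 1) < ε := (min_le_left _ _).trans_lt (half_lt_self hε)
    refine ⟨min (ε / 2) 1, by positivity, min_le_right _ _, fun ξ h hh => ?_⟩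
    by_cases hξ : ξ = 0
    · have : h = 0 := by simpa [hξ] using hh
      rw [this, add_zero]
    obtain ⟨c, η, hc, hcξ, hη, rfl⟩ := exists_eq_smul_norm_one hξ
    have hsplit : c • η + h = c • (η + c⁻¹ • h) := by rw [smul_add, smul_inv_smul₀ hc]
    have hh' : ‖c⁻¹ • h‖ ≤ min (ε / 2) 1 := by
      rw [norm_smul, norm_inv, inv_mul_le_iff₀ (norm_pos_iff.2 hc), mul_comm, hcξ]
      exact hh
    rw [hsplit, hhom c hc, hhom c hc]
    congr 1
    have hlt : ‖MvPolynomial.eval (η + c⁻¹ • h) f - MvPolynomial.eval η f‖ <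
        ‖MvPolynomial.eval ξ₀ f‖ := by
      rw [← dist_eq_norm]
      refine hε' _ ?_ _ (by simpa using hη.le) ?_
      · rw [mem_closedBall_zero_iff]
        exact (IsUltrametricDist.norm_add_le_max _ _).trans
          (max_le hη.le (hh'.trans (min_le_right _ _)))
      · rw [dist_eq_norm, add_sub_cancel_left]
        exact hh'.trans_lt hε2
    rw [symbol, symbol]
    congr 1
    exact Padic.norm_eq_of_norm_sub_lt_right (hlt.trans_le (hmin (by simpa using hη)))

namespace IsHomogeneousSymbol

variable {a : (Fin n → ℚ_[p]) → ℝ} {γ : ℝ}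

theorem nonneg (ha : IsHomogeneousSymbol a γ) (ξ : Fin n → ℚ_[p]) : 0 ≤ a ξ := by
  obtain ⟨c, hc, h⟩ := ha.lower_bound
  exact (by positivity : 0 ≤ c * ‖ξ‖ ^ γ).trans (h ξ)

theorem apply_zero (ha : IsHomogeneousSymbol a γ) : a 0 = 0 := by
  obtain ⟨C, -, h⟩ := ha.upper_bound
  refine le_antisymm ?_ (ha.nonneg 0)
  simpa [Real.zero_rpow ha.degree_pos.ne'] using h 0

theorem eventually_eq (ha : IsHomogeneousSymbol a γ) {ξ : Fin n → ℚ_[p]} (hξ : ξ ≠ 0) :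
    ∀ᶠ η in 𝓝 ξ, a η = a ξ := by
  obtain ⟨ε, hε, -, h⟩ := ha.locally_constant
  filter_upwards [Metric.ball_mem_nhds ξ (mul_pos hε (norm_pos_iff.2 hξ))] with η hη
  rw [Metric.mem_ball, dist_eq_norm] at hη
  rw [← h ξ (η - ξ) hη.le, add_sub_cancel]

/-- The heat symbol decreases faster than any power. -/
theorem exists_exp_le (ha : IsHomogeneousSymbol a γ) {t : ℝ} (ht : 0 < t) (s : ℝ) :
    ∃ C : ℝ, ∀ ξ, Real.exp (-t * a ξ) ≤ C * (max 1 ‖ξ‖) ^ (-s) := by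
  obtain ⟨c, hc, hlow⟩ := ha.lower_bound
  have hγ := ha.degree_pos
  obtain ⟨M, hM⟩ := exists_nat_ge (s / γ)
  have htc : 0 < t * c := mul_pos ht hc
  refine ⟨Real.exp (t * c) * (M.factorial / (t * c) ^ M), fun ξ => ?_⟩
  set y := max 1 ‖ξ‖ with hy
  have hy1 : 1 ≤ y := le_max_left _ _
  have hy0 : 0 < y := one_pos.trans_le hy1
  set z := y ^ γ with hz
  have hz1 : 1 ≤ z := Real.one_le_rpow hy1 hγ.le
  have hz0 : 0 < z := one_pos.trans_le hz1
  have h1 : c * (z - 1) ≤ a ξ := by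
    refine le_trans ?_ (hlow ξ)
    refine mul_le_mul_of_nonneg_left ?_ hc.le
    rcases le_total ‖ξ‖ 1 with h | h
    · rw [hz, hy, max_eq_left h, Real.one_rpow, sub_self]; positivity
    · rw [hz, hy, max_eq_right h]; linarith
  have h2 : Real.exp (-t * a ξ) ≤ Real.exp (t * c) * Real.exp (-(t * c * z)) := by
    rw [← Real.exp_add]
    refine Real.exp_le_exp.2 ?_
    have := mul_le_mul_of_nonneg_left h1 ht.le
    linarith
  have h3 : y ^ s ≤ z ^ M := by
    rw [hz, ← Real.rpow_natCast, ← Real.rpow_mul hy0.le]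
    refine Real.rpow_le_rpow_of_exponent_le hy1 ?_
    rw [mul_comm]; exact (div_le_iff₀ hγ).1 hM
  have h4 : Real.exp (-(t * c * z)) ≤ M.factorial / (t * c) ^ M * (z ^ M)⁻¹ := by
    have := Real.pow_div_factorial_le_exp (t * c * z) (by positivity) M
    rw [Real.exp_neg]
    refine (inv_anti₀ (by positivity) this).trans_eq ?_
    rw [mul_pow]; field_simp
  calc Real.exp (-t * a ξ) ≤ Real.exp (t * c) * Real.exp (-(t * c * z)) := h2
    _ ≤ Real.exp (t * c) * (M.factorial / (t * c) ^ M * (z ^ M)⁻¹) := by gcongr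
    _ ≤ Real.exp (t * c) * (M.factorial / (t * c) ^ M * (y ^ s)⁻¹) := by gcongr
    _ = _ := by rw [Real.rpow_neg hy0.le, mul_assoc]

end IsHomogeneousSymbol

/-! ### The heat kernel of a homogeneous symbol -/

/-- The heat symbol `e^{-t a}` of a general symbol `a`; `heatSymbol f α t` is the case
`a = symbol f α`. -/
noncomputable def expSymbol (a : (Fin n → ℚ_[p]) → ℝ) (t : ℝ) (ξ : Fin n → ℚ_[p]) : ℂ :=
  ((Real.exp (-t * a ξ) : ℝ) : ℂ)

theorem integrable_of_norm_le_max_one_rpow {m : (Fin n → ℚ_[p]) → ℂ} {s C : ℝ}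
    (hm : AEStronglyMeasurable m volume) (hs : (n : ℝ) < s)
    (h : ∀ ξ, ‖m ξ‖ ≤ C * (max 1 ‖ξ‖) ^ (-s)) : Integrable m :=
  ((integrable_max_one_norm_rpow hs).const_mul C).mono' hm (ae_of_all _ h)

theorem memLp_two_of_integrable_of_bdd {m : (Fin n → ℚ_[p]) → ℂ} {C : ℝ} (hm : Integrable m)
    (h : ∀ ξ, ‖m ξ‖ ≤ C) : MemLp m 2 := by
  rw [memLp_two_iff_integrable_sq_norm hm.1]
  refine (hm.norm.const_mul C).mono' (hm.1.norm.pow 2) (ae_of_all _ fun ξ => ?_)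
  rw [Real.norm_of_nonneg (by positivity), sq]
  exact mul_le_mul_of_nonneg_right (h ξ) (norm_nonneg _)

namespace IsHomogeneousSymbol

variable {a : (Fin n → ℚ_[p]) → ℝ} {γ : ℝ}

theorem norm_expSymbol (a : (Fin n → ℚ_[p]) → ℝ) (t : ℝ) (ξ : Fin n → ℚ_[p]) :
    ‖expSymbol a t ξ‖ = Real.exp (-t * a ξ) := by
  rw [expSymbol, Complex.norm_real, Real.norm_of_nonneg (Real.exp_pos _).le]

theorem continuous_expSymbol (ha : IsHomogeneousSymbol a γ) (t : ℝ) :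
    Continuous (expSymbol a t) :=
  Complex.continuous_ofReal.comp (Real.continuous_exp.comp (continuous_const.mul ha.continuous))

theorem norm_expSymbol_le_one (ha : IsHomogeneousSymbol a γ) {t : ℝ} (ht : 0 ≤ t)
    (ξ : Fin n → ℚ_[p]) : ‖expSymbol a t ξ‖ ≤ 1 := by
  rw [norm_expSymbol, Real.exp_le_one_iff, neg_mul]
  exact neg_nonpos.2 (mul_nonneg ht (ha.nonneg ξ))

theorem expSymbol_anti (ha : IsHomogeneousSymbol a γ) {s t : ℝ} (hst : s ≤ t)
    (ξ : Fin n → ℚ_[p]) : ‖expSymbol a t ξ‖ ≤ ‖expSymbol a s ξ‖ := by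
  rw [norm_expSymbol, norm_expSymbol, Real.exp_le_exp]
  exact mul_le_mul_of_nonneg_right (neg_le_neg hst) (ha.nonneg ξ)

theorem eventually_expSymbol_eq (ha : IsHomogeneousSymbol a γ) (t : ℝ) {ξ : Fin n → ℚ_[p]}
    (hξ : ξ ≠ 0) : ∀ᶠ η in 𝓝 ξ, expSymbol a t η = expSymbol a t ξ := by
  filter_upwards [ha.eventually_eq hξ] with η hη
  rw [expSymbol, expSymbol, hη]

/-- A symbol of polynomial growth times the heat symbol is bounded and square-integrable. -/
theorem exists_bound_mul_expSymbol (ha : IsHomogeneousSymbol a γ) {t : ℝ} (ht : 0 < t)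
    {b : (Fin n → ℚ_[p]) → ℝ} (hb : Continuous b) {C r : ℝ}
    (hbC : ∀ ξ, |b ξ| ≤ C * (max 1 ‖ξ‖) ^ r) :
    (∃ B : ℝ, ∀ ξ, ‖(b ξ : ℂ) * expSymbol a t ξ‖ ≤ B) ∧
      MemLp (fun ξ => (b ξ : ℂ) * expSymbol a t ξ) 2 := by
  obtain ⟨C', hC'⟩ := ha.exists_exp_le ht (r + (n + 1))
  have hcont : Continuous fun ξ => (b ξ : ℂ) * expSymbol a t ξ :=
    (Complex.continuous_ofReal.comp hb).mul (ha.continuous_expSymbol t)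
  have hle : ∀ ξ, ‖(b ξ : ℂ) * expSymbol a t ξ‖ ≤ C * C' * (max 1 ‖ξ‖) ^ (-((n : ℝ) + 1)) := by
    intro ξ
    have hy : 0 < max 1 ‖ξ‖ := one_pos.trans_le (le_max_left _ _)
    rw [norm_mul, norm_expSymbol, Complex.norm_real, Real.norm_eq_abs]
    calc |b ξ| * Real.exp (-t * a ξ)
        ≤ (C * (max 1 ‖ξ‖) ^ r) * (C' * (max 1 ‖ξ‖) ^ (-(r + (n + 1)))) :=
          mul_le_mul (hbC ξ) (hC' ξ) (Real.exp_pos _).le ((abs_nonneg _).trans (hbC ξ))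
      _ = C * C' * ((max 1 ‖ξ‖) ^ r * (max 1 ‖ξ‖) ^ (-(r + (n + 1)))) := by ring
      _ = _ := by rw [← Real.rpow_add hy]; congr 2; ring
  have hCC : 0 ≤ C * C' := by
    have := (norm_nonneg _).trans (hle 0)
    simpa using this
  have hbd : ∀ ξ, ‖(b ξ : ℂ) * expSymbol a t ξ‖ ≤ C * C' := by
    intro ξ
    refine (hle ξ).trans (mul_le_of_le_one_right hCC ?_)
    exact Real.rpow_le_one_of_one_le_of_nonpos (le_max_left _ _) 
      (by linarith [(n.cast_nonneg : (0 : ℝ) ≤ n)])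
  exact ⟨⟨_, hbd⟩, memLp_two_of_integrable_of_bdd
    (integrable_of_norm_le_max_one_rpow hcont.aestronglyMeasurable (by linarith) hle) hbd⟩

theorem integrable_expSymbol (ha : IsHomogeneousSymbol a γ) {t : ℝ} (ht : 0 < t) :
    Integrable (expSymbol a t) := by
  obtain ⟨C, hC⟩ := ha.exists_exp_le ht (n + 1)
  exact integrable_of_norm_le_max_one_rpow (s := (n : ℝ) + 1)
    (ha.continuous_expSymbol t).aestronglyMeasurable (by linarith)
    fun ξ => by rw [norm_expSymbol]; exact hC ξ

theorem memLp_expSymbol (ha : IsHomogeneousSymbol a γ) {t : ℝ} (ht : 0 < t) :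
    MemLp (expSymbol a t) 2 :=
  memLp_two_of_integrable_of_bdd (ha.integrable_expSymbol ht) (ha.norm_expSymbol_le_one ht.le)

theorem abs_le (ha : IsHomogeneousSymbol a γ) :
    ∃ C : ℝ, ∀ ξ, |a ξ| ≤ C * (max 1 ‖ξ‖) ^ γ := by
  obtain ⟨C, hC, h⟩ := ha.upper_bound
  refine ⟨C, fun ξ => ?_⟩
  rw [abs_of_nonneg (ha.nonneg ξ)]
  refine (h ξ).trans (mul_le_mul_of_nonneg_left ?_ hC.le)
  exact Real.rpow_le_rpow (norm_nonneg _) (le_max_right _ _) ha.degree_pos.le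

/-- Decay of the heat kernel. On the ball of radius `R ∼ 1 / ‖x‖` replace the symbol by `1`. The
result is invariant under a translation `h` with `Ψ(x·h) ≠ 1`, hence contributes nothing, and the
error is at most `∫_{‖ξ‖ ≤ R} t a(ξ) dξ`. -/
theorem exists_norm_fourierInv_expSymbol_le (ha : IsHomogeneousSymbol a γ) :
    ∃ C : ℝ, ∀ t : ℝ, 0 < t → ∀ x : Fin n → ℚ_[p], x ≠ 0 →
      ‖fourierInv (expSymbol a t) x‖ ≤ C * t * ‖x‖ ^ (-(γ + n)) := by
  obtain ⟨ε, hε, hε1, hloc⟩ := ha.locally_constant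
  obtain ⟨C, hC, hup⟩ := ha.upper_bound
  -- `‖ξ‖ > ‖b‖ ‖h‖` implies `‖h‖ ≤ ε ‖ξ‖`, so `a` is invariant under `h` outside such a ball.
  have hγ := ha.degree_pos
  obtain ⟨b, hb⟩ := NormedField.exists_lt_norm ℚ_[p] ε⁻¹
  have hb1 : 1 < ‖b‖ := (one_le_inv₀ hε |>.2 hε1).trans_lt hb
  have hb0 : b ≠ 0 := norm_pos_iff.1 (one_pos.trans hb1)
  have hpr : (1 : ℝ) < p := one_lt_natCast_prime p
  set κ : ℝ := ‖b‖ * p with hκ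
  have hκ0 : 0 < κ := by positivity
  refine ⟨C * κ ^ (γ + n), fun t ht x hx => ?_⟩
  have hxp : 0 < ‖x‖ := norm_pos_iff.2 hx
  -- `c` is a scalar with `‖c‖ = p / ‖x‖`, so that `h` can be chosen with `‖h‖ ≤ ‖c‖`; the ball
  -- on which the symbol is replaced has radius `‖b * c‖`.
  obtain ⟨i, hi⟩ := exists_norm_apply_eq hx
  have hxi : x i ≠ 0 := by rw [← norm_ne_zero_iff, hi]; exact hxp.ne'
  set c : ℚ_[p] := (p * x i)⁻¹ with hcdef
  have hc : c ≠ 0 := inv_ne_zero (mul_ne_zero natCast_prime_ne_zero hxi)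
  have hcn : ‖c‖ = p / ‖x‖ := by
    rw [hcdef, norm_inv, norm_mul, Padic.norm_p, hi, mul_inv, inv_inv, div_eq_mul_inv]
  have hbc : b * c ≠ 0 := mul_ne_zero hb0 hc
  have hR : ‖b * c‖ = κ / ‖x‖ := by rw [norm_mul, hcn, hκ, mul_div_assoc]
  obtain ⟨h, hh1, hh2⟩ := exists_psi_pairing_ne_one_of_lt hc (x := x) (by
    rw [hcn, inv_div, div_lt_iff₀ (by positivity)]
    exact lt_mul_of_one_lt_right hxp hpr)
  have hhR : ‖h‖ ≤ ‖b * c‖ := by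
    rw [norm_mul]; exact hh1.trans (le_mul_of_one_le_left (norm_nonneg _) hb1.le)
  set B : Set (Fin n → ℚ_[p]) := Metric.closedBall 0 ‖b * c‖ with hB
  have hBm : MeasurableSet B := Metric.isClosed_closedBall.measurableSet
  let E : (Fin n → ℚ_[p]) → ℂ := B.indicator fun ξ => expSymbol a t ξ - 1
  have hBfin : volume B ≠ ⊤ := (isCompact_closedBall _ _).measure_lt_top.ne
  have hEint : Integrable E :=
    ((ha.integrable_expSymbol ht).integrableOn.sub (integrableOn_const
      hBfin)).integrable_indicator hBm
  have hper : fourierInv (expSymbol a t - E) x = 0 := by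
    refine fourierInv_eq_zero_of_periodic (h := h) (fun ξ => ?_) hh2
    by_cases hξ : ‖ξ‖ ≤ ‖b * c‖
    · have h1 : ξ ∈ B := by simpa [hB] using hξ
      have h2 : ξ + h ∈ B := by
        rw [hB, mem_closedBall_zero_iff]
        exact (norm_add_le_iff_of_norm_le hhR).2 hξ
      simp [E, Set.indicator_of_mem h1, Set.indicator_of_mem h2]
    · have h1 : ξ ∉ B := by simpa [hB] using hξ
      have h2 : ξ + h ∉ B := by
        rw [hB, mem_closedBall_zero_iff]
        exact fun hc => hξ ((norm_add_le_iff_of_norm_le hhR).1 hc)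
      have h3 : a (ξ + h) = a ξ := by
        refine hloc ξ h (hh1.trans ?_)
        rw [not_le, norm_mul] at hξ
        calc ‖c‖ = ε * (ε⁻¹ * ‖c‖) := by field_simp
          _ ≤ ε * (‖b‖ * ‖c‖) := by gcongr
          _ ≤ ε * ‖ξ‖ := by gcongr
      simp [E, Set.indicator_of_notMem h1, Set.indicator_of_notMem h2, expSymbol, h3]
  have hZ : fourierInv (expSymbol a t) x = fourierInv E x := by
    rw [fourierInv_sub (ha.integrable_expSymbol ht) hEint, Pi.sub_apply, sub_eq_zero] at hper
    exact hper
  have hE : ∀ ξ, ‖E ξ‖ ≤ B.indicator (fun _ => t * (C * (κ / ‖x‖) ^ γ)) ξ := by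
    intro ξ
    by_cases hξ : ξ ∈ B
    · simp only [E, Set.indicator_of_mem hξ]
      rw [hB, mem_closedBall_zero_iff, hR] at hξ
      have h1 : a ξ ≤ C * (κ / ‖x‖) ^ γ :=
        (hup ξ).trans (mul_le_mul_of_nonneg_left
          (Real.rpow_le_rpow (norm_nonneg _) hξ hγ.le) hC.le)
      have h0 := ha.nonneg ξ
      have h2 : Real.exp (-t * a ξ) ≤ 1 := Real.exp_le_one_iff.2 (by nlinarith)
      have h3 := Real.add_one_le_exp (-t * a ξ)
      rw [expSymbol, ← Complex.ofReal_one, ← Complex.ofReal_sub, Complex.norm_real,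
        Real.norm_eq_abs, abs_of_nonpos (by linarith)]
      have h4 := mul_le_mul_of_nonneg_left h1 ht.le
      linarith
    · simp [E, Set.indicator_of_notMem hξ]
  calc ‖fourierInv (expSymbol a t) x‖ = ‖fourierInv E x‖ := by rw [hZ]
    _ ≤ ∫ ξ, ‖E ξ‖ := norm_fourierInv_le E x
    _ ≤ ∫ ξ, B.indicator (fun _ => t * (C * (κ / ‖x‖) ^ γ)) ξ :=
        integral_mono hEint.norm ((integrableOn_const hBfin).integrable_indicator hBm) hE
    _ = ‖b * c‖ ^ n * (t * (C * (κ / ‖x‖) ^ γ)) := by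
        rw [integral_indicator hBm, setIntegral_const, measureReal_pi_closedBall_norm hbc,
          smul_eq_mul]
    _ = C * κ ^ (γ + n) * t * ‖x‖ ^ (-(γ + n)) := by
        rw [hR, Real.rpow_neg hxp.le, Real.rpow_add hκ0, Real.rpow_add hxp, Real.rpow_natCast,
          Real.rpow_natCast, Real.div_rpow hκ0.le hxp.le, div_pow]
        field_simp

/-- A bound that is uniform for `t` in a compact subinterval of `(0, ∞)`. -/
theorem exists_norm_fourierInv_expSymbol_le_max (ha : IsHomogeneousSymbol a γ) (T : ℝ) :
    ∃ C : ℝ, ∀ t : ℝ, 1 ≤ t → t ≤ T → ∀ x : Fin n → ℚ_[p],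
      ‖fourierInv (expSymbol a t) x‖ ≤ C * (max 1 ‖x‖) ^ (-(γ + n)) := by
  obtain ⟨C, hC⟩ := ha.exists_norm_fourierInv_expSymbol_le
  refine ⟨max (∫ ξ, ‖expSymbol a 1 ξ‖) (|C| * T), fun t ht htT x => ?_⟩
  have ht0 : 0 < t := one_pos.trans_le ht
  rcases le_or_gt ‖x‖ 1 with hx | hx
  · rw [max_eq_left hx, Real.one_rpow, mul_one]
    refine (norm_fourierInv_le _ x).trans ((integral_mono ?_ ?_ ?_).trans (le_max_left _ _))
    · exact (ha.integrable_expSymbol ht0).norm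
    · exact (ha.integrable_expSymbol one_pos).norm
    · exact fun ξ => ha.expSymbol_anti ht ξ
  · rw [max_eq_right hx.le]
    have hx0 : x ≠ 0 := norm_pos_iff.1 (one_pos.trans hx)
    refine (hC t ht0 x hx0).trans (mul_le_mul_of_nonneg_right ?_ (by positivity))
    refine le_trans ?_ (le_max_right _ _)
    exact mul_le_mul (le_abs_self C) htT ht0.le (abs_nonneg C)

theorem fourierInv_expSymbol_mul (ha : IsHomogeneousSymbol a γ) {c : ℚ_[p]} (hc : c ≠ 0) (t : ℝ)
    (x : Fin n → ℚ_[p]) : fourierInv (expSymbol a (t * ‖c‖ ^ γ)) (c • x) =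
      ((‖c‖ ^ n)⁻¹ : ℝ) • fourierInv (expSymbol a t) x := by
  rw [fourierInv, fourierInv, ← integral_comp_smul hc]
  congr 1; ext ξ
  rw [pairing_smul_left, pairing_smul_right, expSymbol, expSymbol, ha.homogeneous c hc]
  ring_nf

/-- The scaling `t ↦ t ‖c‖ ^ γ` reduces every time to a time in a fundamental interval. -/
theorem exists_eq_mul_norm_rpow (ha : IsHomogeneousSymbol a γ) {t : ℝ} (ht : 0 < t) :
    ∃ (c : ℚ_[p]) (s : ℝ), c ≠ 0 ∧ 1 ≤ s ∧ s ≤ (p : ℝ) ^ γ ∧ t = s * ‖c‖ ^ γ := by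
  have hp1 := one_lt_natCast_prime p
  have hpr : (0 : ℝ) < p := by positivity
  have hq : 1 < (p : ℝ) ^ γ := Real.one_lt_rpow hp1 ha.degree_pos
  have hq0 : 0 < (p : ℝ) ^ γ := one_pos.trans hq
  obtain ⟨j, hj1, hj2⟩ := exists_mem_Ico_zpow ht hq
  have hqj : 0 < ((p : ℝ) ^ γ) ^ j := zpow_pos hq0 j
  refine ⟨(p : ℚ_[p]) ^ (-j), t / ((p : ℝ) ^ γ) ^ j, zpow_ne_zero _ natCast_prime_ne_zero,
    ?_, ?_, ?_⟩
  · rwa [one_le_div hqj]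
  · rw [div_le_iff₀ hqj, mul_comm, ← zpow_add_one₀ hq0.ne']
    exact hj2.le
  · have : ((p : ℝ) ^ j) ^ γ = ((p : ℝ) ^ γ) ^ j := by
      rw [← Real.rpow_intCast, ← Real.rpow_intCast, ← Real.rpow_mul hpr.le, ← Real.rpow_mul hpr.le,
        mul_comm]
    rw [norm_prime_zpow, this, div_mul_cancel₀ _ hqj.ne']

theorem integrable_fourierInv_expSymbol (ha : IsHomogeneousSymbol a γ) {t : ℝ} (ht : 0 < t) :
    Integrable (fourierInv (expSymbol a t)) := by
  obtain ⟨c, s, hc, hs1, hs2, rfl⟩ := ha.exists_eq_mul_norm_rpow ht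
  obtain ⟨C, hC⟩ := ha.exists_norm_fourierInv_expSymbol_le_max ((p : ℝ) ^ γ)
  have h1 : Integrable (fourierInv (expSymbol a s)) :=
    integrable_of_norm_le_max_one_rpow (continuous_fourierInv
      (ha.integrable_expSymbol (one_pos.trans_le hs1))).aestronglyMeasurable
      (by linarith [ha.degree_pos]) (hC s hs1 hs2)
  have h2 := (integrable_comp_smul (inv_ne_zero hc) h1).smul ((‖c‖ ^ n)⁻¹ : ℝ)
  refine h2.congr (ae_of_all _ fun x => ?_)
  simp only [Pi.smul_apply]
  rw [← ha.fourierInv_expSymbol_mul hc, smul_inv_smul₀ hc]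

theorem memLp_fourierInv_expSymbol (ha : IsHomogeneousSymbol a γ) {t : ℝ} (ht : 0 < t) :
    MemLp (fourierInv (expSymbol a t)) 2 :=
  memLp_two_of_integrable_of_bdd (ha.integrable_fourierInv_expSymbol ht)
    fun x => norm_fourierInv_le _ x

/-- The heat kernel has mass `1`: its mass on the ball of radius `‖c‖` is the mean of the heat
symbol over the ball of radius `‖c‖⁻¹`, which tends to the value of the symbol at `0`. -/
theorem integral_fourierInv_expSymbol (ha : IsHomogeneousSymbol a γ) {t : ℝ} (ht : 0 < t) :
    ∫ x, fourierInv (expSymbol a t) x = 1 := by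
  let c : ℕ → ℚ_[p] := fun k => ((p : ℚ_[p]) ^ k)⁻¹
  have hc : ∀ k, c k ≠ 0 := fun k => inv_ne_zero (pow_ne_zero k natCast_prime_ne_zero)
  have hcn : ∀ k, ‖c k‖ = (p : ℝ) ^ k := fun k => by
    rw [norm_inv, norm_pow, Padic.norm_p, inv_pow, inv_inv]
  let I : ℕ → (Fin n → ℚ_[p]) → ℂ := fun k =>
    (Metric.closedBall 0 ‖c k‖).indicator fun _ => (1 : ℂ)
  have hI : ∀ k, IsSchwartzBruhat (I k) := fun k => isSchwartzBruhat_indicator_closedBall (hc k)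
  have hIle : ∀ k x, ‖I k x‖ ≤ 1 := fun k x =>
    (norm_indicator_le_norm_self _ _).trans (by simp)
  have hp1 := one_lt_natCast_prime p
  have hlhs : Tendsto (fun k => ∫ x, fourierInv (expSymbol a t) x * I k x) atTop
      (𝓝 (∫ x, fourierInv (expSymbol a t) x)) := by
    have hZ := ha.integrable_fourierInv_expSymbol ht
    refine tendsto_integral_of_dominated_convergence (fun x => ‖fourierInv (expSymbol a t) x‖)
      (fun k => hZ.1.mul (hI k).continuous.aestronglyMeasurable) hZ.norm
      (fun k => ae_of_all _ fun x => ?_) (ae_of_all _ fun x => ?_)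
    · rw [norm_mul]; exact mul_le_of_le_one_right (norm_nonneg _) (hIle k x)
    · refine tendsto_const_nhds.congr' ?_
      filter_upwards [(tendsto_pow_atTop_atTop_of_one_lt hp1).eventually_ge_atTop ‖x‖] with k hk
      simp only [I]
      rw [Set.indicator_of_mem, mul_one]
      rwa [mem_closedBall_zero_iff, hcn]
  have hrhs : ∀ k, ∫ x, fourierInv (expSymbol a t) x * I k x =
      ∫ ξ, expSymbol a t ((c k)⁻¹ • ξ) *
        (Metric.closedBall (0 : Fin n → ℚ_[p]) ‖(1 : ℚ_[p])‖).indicator (fun _ => (1 : ℂ)) ξ := by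
    intro k
    have hcp : 0 < ‖c k‖ := norm_pos_iff.2 (hc k)
    have h1 := integral_comp_smul (inv_ne_zero (hc k))
      (fun ξ => expSymbol a t ξ * (Metric.closedBall (0 : Fin n → ℚ_[p]) ‖(c k)⁻¹‖).indicator
        (fun _ => (1 : ℂ)) ξ)
    have h2 : ∀ ξ : Fin n → ℚ_[p], (Metric.closedBall (0 : Fin n → ℚ_[p]) ‖(c k)⁻¹‖).indicator
        (fun _ => (1 : ℂ)) ((c k)⁻¹ • ξ) =
        (Metric.closedBall (0 : Fin n → ℚ_[p]) ‖(1 : ℚ_[p])‖).indicator (fun _ => (1 : ℂ)) ξ := by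
      intro ξ
      have : 0 < ‖c k‖⁻¹ := inv_pos.2 hcp
      simp only [Set.indicator, mem_closedBall_zero_iff, norm_smul, norm_inv, norm_one,
        mul_le_iff_le_one_right this]
    simp_rw [h2] at h1
    rw [h1, integral_fourierInv_mul (ha.integrable_expSymbol ht) (hI k).integrable,
      ← integral_smul]
    congr 1; ext ξ
    simp only [I]
    rw [fourierInv_indicator_closedBall (hc k)]
    by_cases hξ : ξ ∈ Metric.closedBall (0 : Fin n → ℚ_[p]) ‖(c k)⁻¹‖
    · rw [Set.indicator_of_mem hξ, Set.indicator_of_mem hξ, norm_inv, inv_pow, inv_inv, mul_one,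
        Complex.real_smul, mul_comm]
    · rw [Set.indicator_of_notMem hξ, Set.indicator_of_notMem hξ, mul_zero, smul_zero]
  have hlim : Tendsto (fun k => ∫ ξ, expSymbol a t ((c k)⁻¹ • ξ) *
        (Metric.closedBall (0 : Fin n → ℚ_[p]) ‖(1 : ℚ_[p])‖).indicator (fun _ => (1 : ℂ)) ξ) atTop
      (𝓝 (∫ ξ, (Metric.closedBall (0 : Fin n → ℚ_[p]) ‖(1 : ℚ_[p])‖).indicator
        (fun _ => (1 : ℂ)) ξ)) := by
    have hI0 := isSchwartzBruhat_indicator_closedBall (n := n) (one_ne_zero (α := ℚ_[p]))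
    refine tendsto_integral_of_dominated_convergence
      (fun ξ => ‖(Metric.closedBall (0 : Fin n → ℚ_[p]) ‖(1 : ℚ_[p])‖).indicator
        (fun _ => (1 : ℂ)) ξ‖)
      (fun k => (((ha.continuous_expSymbol t).comp (continuous_const_smul _)).mul
        hI0.continuous).aestronglyMeasurable) hI0.integrable.norm
      (fun k => ae_of_all _ fun ξ => ?_) (ae_of_all _ fun ξ => ?_)
    · rw [norm_mul]
      exact mul_le_of_le_one_left (norm_nonneg _) (ha.norm_expSymbol_le_one ht.le _)
    · have h0 : Tendsto (fun k => (c k)⁻¹ • ξ) atTop (𝓝 ((0 : ℚ_[p]) • ξ)) := by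
        refine Tendsto.smul_const ?_ ξ
        simp only [c, inv_inv]
        refine tendsto_pow_atTop_nhds_zero_of_norm_lt_one ?_
        rw [Padic.norm_p]
        exact inv_lt_one_of_one_lt₀ hp1
      have h1 := ((ha.continuous_expSymbol t).tendsto _).comp h0
      have h2 : expSymbol a t ((0 : ℚ_[p]) • ξ) = 1 := by
        rw [zero_smul, expSymbol, ha.apply_zero]; simp
      rw [h2] at h1
      simpa using h1.mul_const ((Metric.closedBall (0 : Fin n → ℚ_[p]) ‖(1 : ℚ_[p])‖).indicator
        (fun _ => (1 : ℂ)) ξ)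
  have hone : ∫ ξ, (Metric.closedBall (0 : Fin n → ℚ_[p]) ‖(1 : ℚ_[p])‖).indicator
      (fun _ => (1 : ℂ)) ξ = 1 := by
    rw [integral_indicator Metric.isClosed_closedBall.measurableSet, setIntegral_const,
      measureReal_pi_closedBall_norm one_ne_zero]
    simp
  simp_rw [hrhs] at hlhs
  rw [hone] at hlim
  exact tendsto_nhds_unique hlhs hlim

end IsHomogeneousSymbol

/-! ### The Cauchy problem -/

theorem fourierInv_comp_sub (φ : (Fin n → ℚ_[p]) → ℂ) (x ξ : Fin n → ℚ_[p]) :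
    fourierInv (fun η => φ (x - η)) ξ = psi (pairing x ξ) * fourier φ ξ := by
  rw [fourierInv, ← integral_sub_left_eq_self _ _ x, fourier, ← integral_const_mul]
  congr 1; ext y
  rw [sub_sub_cancel, pairing_comm ξ, sub_eq_add_neg, pairing_add_left, pairing_neg_left, psi_add,
    mul_assoc]

theorem memLp_comp_sub {φ : (Fin n → ℚ_[p]) → ℂ} (hφ : MemLp φ 2) (x : Fin n → ℚ_[p]) :
    MemLp (fun η => φ (x - η)) 2 :=
  hφ.comp_measurePreserving (Measure.measurePreserving_sub_left volume x)

namespace IsHomogeneousSymbol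

variable {a : (Fin n → ℚ_[p]) → ℝ} {γ : ℝ}

/-- Convolution with the heat kernel is the Fourier multiplier with the heat symbol: for
Schwartz--Bruhat functions this is Fubini's theorem, and both sides are continuous in `L²`. -/
theorem integral_fourierInv_expSymbol_mul_comp_sub (ha : IsHomogeneousSymbol a γ) {t : ℝ}
    (ht : 0 < t) {φ Φ : (Fin n → ℚ_[p]) → ℂ} (h : IsL2Fourier φ Φ) (x : Fin n → ℚ_[p]) :
    ∫ η, fourierInv (expSymbol a t) η * φ (x - η) = fourierInv (expSymbol a t * Φ) x := by
  obtain ⟨hφ, hΦ, ψ, hψ, h1, h2⟩ := h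
  have hl := tendsto_integral_mul_of_tendsto_eLpNorm (ha.memLp_fourierInv_expSymbol ht)
    (memLp_comp_sub hφ x) (fun k => memLp_comp_sub ((hψ k).memLp 2) x) (by
      refine h1.congr fun k => ?_
      exact (eLpNorm_comp_measurePreserving (((hψ k).memLp 2).sub hφ).1
        (Measure.measurePreserving_sub_left volume x)).symm)
  have hpm : MemLp (fun ξ => psi (pairing x ξ) * expSymbol a t ξ) 2 :=
    memLp_mul_of_bdd (C := 1) (continuous_psi_pairing x).aestronglyMeasurable (fun ξ => by simp)
      (ha.memLp_expSymbol ht)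
  have hr := tendsto_integral_mul_of_tendsto_eLpNorm hpm hΦ (fun k => (hψ k).fourier.memLp 2) h2
  have heq : ∀ k, ∫ η, fourierInv (expSymbol a t) η * ψ k (x - η) =
      ∫ ξ, psi (pairing x ξ) * expSymbol a t ξ * fourier (ψ k) ξ := by
    intro k
    rw [integral_fourierInv_mul (ha.integrable_expSymbol ht) ((hψ k).integrable.comp_sub_left x)]
    congr 1; ext ξ
    rw [fourierInv_comp_sub]; ring
  simp_rw [heq] at hl
  rw [tendsto_nhds_unique hl hr]
  simp only [fourierInv, Pi.mul_apply, mul_assoc]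

/-- Dominated convergence, with the value of the integrand at a smaller time as a majorant. -/
theorem continuousOn_fourierInv_mul_expSymbol (ha : IsHomogeneousSymbol a γ)
    {b : (Fin n → ℚ_[p]) → ℝ}
    (hb : ∀ t, 0 < t → MemLp (fun ξ => (b ξ : ℂ) * expSymbol a t ξ) 2)
    {Φ : (Fin n → ℚ_[p]) → ℂ} (hΦ : MemLp Φ 2) :
    ContinuousOn (fun q : (Fin n → ℚ_[p]) × ℝ =>
      fourierInv ((fun ξ => (b ξ : ℂ) * expSymbol a q.2 ξ) * Φ) q.1) {q | 0 < q.2} := by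
  rintro ⟨x₀, t₀⟩ (ht₀ : 0 < t₀)
  refine ContinuousAt.continuousWithinAt ?_
  have hnear : ∀ᶠ q : (Fin n → ℚ_[p]) × ℝ in 𝓝 (x₀, t₀), t₀ / 2 < q.2 :=
    continuous_snd.continuousAt.eventually_const_lt (half_lt_self ht₀)
  refine continuousAt_of_dominated
    (bound := fun ξ => ‖((fun ξ => (b ξ : ℂ) * expSymbol a (t₀ / 2) ξ) * Φ) ξ‖) ?_ ?_
    ((hb _ (half_pos ht₀)).integrable_mul hΦ).norm ?_
  · filter_upwards [hnear] with q hq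
    exact (integrable_psi_pairing_mul ((hb _ ((half_pos ht₀).trans hq)).integrable_mul hΦ)
      q.1).aestronglyMeasurable
  · filter_upwards [hnear] with q hq
    refine ae_of_all _ fun ξ => ?_
    simp only [Pi.mul_apply, norm_mul, norm_psi, one_mul]
    gcongr
    exact ha.expSymbol_anti hq.le ξ
  · refine ae_of_all _ fun ξ => Continuous.continuousAt ?_
    have h1 : Continuous fun q : (Fin n → ℚ_[p]) × ℝ => psi (pairing q.1 ξ) :=
      continuous_psi.comp (continuous_pairing.comp (by fun_prop : Continuous
        fun q : (Fin n → ℚ_[p]) × ℝ => (q.1, ξ)))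
    have h2 : Continuous fun q : (Fin n → ℚ_[p]) × ℝ => expSymbol a q.2 ξ := by
      unfold expSymbol; fun_prop
    simp only [Pi.mul_apply]
    fun_prop

/-- Differentiation under the integral sign. -/
theorem hasDerivAt_fourierInv_expSymbol_mul (ha : IsHomogeneousSymbol a γ)
    {Φ : (Fin n → ℚ_[p]) → ℂ} (hΦ : MemLp Φ 2)
    (hb : ∀ t, 0 < t → MemLp (fun ξ => (a ξ : ℂ) * expSymbol a t ξ) 2) {t : ℝ} (ht : 0 < t)
    (x : Fin n → ℚ_[p]) :
    HasDerivAt (fun s => fourierInv (expSymbol a s * Φ) x)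
      (-fourierInv ((fun ξ => (a ξ : ℂ) * expSymbol a t ξ) * Φ) x) t := by
  have hint : ∀ s, 0 < s → Integrable fun ξ => psi (pairing x ξ) * (expSymbol a s * Φ) ξ :=
    fun s hs => integrable_psi_pairing_mul ((ha.memLp_expSymbol hs).integrable_mul hΦ) x
  have hint' : ∀ s, 0 < s → Integrable fun ξ =>
      psi (pairing x ξ) * ((fun ξ => (a ξ : ℂ) * expSymbol a s ξ) * Φ) ξ :=
    fun s hs => integrable_psi_pairing_mul ((hb s hs).integrable_mul hΦ) x
  have hs : Set.Ioi (t / 2) ∈ 𝓝 t := Ioi_mem_nhds (half_lt_self ht)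
  have h := (hasDerivAt_integral_of_dominated_loc_of_deriv_le (μ := volume)
    (F := fun s ξ => psi (pairing x ξ) * (expSymbol a s * Φ) ξ)
    (F' := fun s ξ => -(psi (pairing x ξ) * ((fun ξ => (a ξ : ℂ) * expSymbol a s ξ) * Φ) ξ))
    (bound := fun ξ => ‖((fun ξ => (a ξ : ℂ) * expSymbol a (t / 2) ξ) * Φ) ξ‖) hs
    (by
      filter_upwards [hs] with s hs
      exact (hint s ((half_pos ht).trans hs)).aestronglyMeasurable)
    (hint t ht) (hint' t ht).neg.aestronglyMeasurable
    (ae_of_all _ fun ξ s hs => ?_)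
    ((hb _ (half_pos ht)).integrable_mul hΦ).norm
    (ae_of_all _ fun ξ s _ => ?_)).2
  · rw [integral_neg] at h
    exact h
  · simp only [Pi.mul_apply, norm_neg, norm_mul, norm_psi, one_mul]
    gcongr
    exact ha.expSymbol_anti (le_of_lt hs) ξ
  · have h1 : HasDerivAt (fun s : ℝ => expSymbol a s ξ) (-((a ξ : ℂ) * expSymbol a s ξ)) s := by
      have h2 : HasDerivAt (fun s : ℝ => Real.exp (-s * a ξ))
          (Real.exp (-s * a ξ) * (-1 * a ξ)) s :=
        (((hasDerivAt_id s).neg).mul_const (a ξ)).exp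
      refine h2.ofReal_comp.congr_deriv ?_
      rw [expSymbol]; push_cast; ring
    refine ((h1.mul_const (Φ ξ)).const_mul (psi (pairing x ξ))).congr_deriv ?_
    simp only [Pi.mul_apply]; ring

/-- The heat kernels form an approximate identity: after scaling the time into a fundamental
interval, `u(x, t) - φ(x₀)` is at most `∫ M(η) ‖φ(x - c η) - φ(x₀)‖ dη` for a fixed integrable
majorant `M` of the kernels and a scalar `c` with `‖c‖ ^ γ ≤ t`. -/
theorem tendsto_integral_fourierInv_expSymbol_mul (ha : IsHomogeneousSymbol a γ)
    {φ : (Fin n → ℚ_[p]) → ℂ} (hφ : Continuous φ) {C : ℝ} (hC : ∀ x, ‖φ x‖ ≤ C)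
    (x₀ : Fin n → ℚ_[p]) {ε : ℝ} (hε : 0 < ε) :
    ∀ᶠ q : (Fin n → ℚ_[p]) × ℝ in 𝓝 (x₀, 0), 0 < q.2 →
      dist (∫ η, fourierInv (expSymbol a q.2) η * φ (q.1 - η)) (φ x₀) < ε := by
  obtain ⟨A, hA⟩ := ha.exists_norm_fourierInv_expSymbol_le_max ((p : ℝ) ^ γ)
  have hγ := ha.degree_pos
  have hA0 : 0 ≤ A := by
    have := (norm_nonneg _).trans (hA 1 le_rfl
      (Real.one_le_rpow (one_lt_natCast_prime p).le hγ.le) 0)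
    simpa using this
  let M : (Fin n → ℚ_[p]) → ℝ := fun η => A * (max 1 ‖η‖) ^ (-(γ + n))
  have hM : Integrable M := (integrable_max_one_norm_rpow (by linarith)).const_mul A
  have hM0 : ∀ η, 0 ≤ M η := fun η => by positivity
  have hJint : ∀ (x : Fin n → ℚ_[p]) (c : ℚ_[p]),
      Continuous fun η => ‖φ (x - c • η) - φ x₀‖ := fun x c => by fun_prop
  have hJle : ∀ y, ‖φ y - φ x₀‖ ≤ C + C := fun y =>
    (norm_sub_le _ _).trans (add_le_add (hC _) (hC _))
  let J : (Fin n → ℚ_[p]) × ℚ_[p] → ℝ := fun q => ∫ η, M η * ‖φ (q.1 - q.2 • η) - φ x₀‖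
  have hJ : Continuous J := by
    refine continuous_of_dominated (bound := fun η => M η * (C + C)) (fun q => ?_) (fun q => ?_)
      (hM.mul_const _) (ae_of_all _ fun η => by fun_prop)
    · exact hM.1.mul (hJint q.1 q.2).aestronglyMeasurable
    · refine ae_of_all _ fun η => ?_
      rw [Real.norm_of_nonneg (mul_nonneg (hM0 η) (norm_nonneg _))]
      exact mul_le_mul_of_nonneg_left (hJle _) (hM0 η)
  have hJ0 : J (x₀, 0) = 0 := by simp [J]
  have hJε : ∀ᶠ q in 𝓝 (x₀, (0 : ℚ_[p])), J q < ε :=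
    hJ.continuousAt.eventually_lt_const (by rwa [hJ0])
  obtain ⟨ρ, hρ, hρ'⟩ := Metric.eventually_nhds_iff.1 hJε
  have h1 : ∀ᶠ q : (Fin n → ℚ_[p]) × ℝ in 𝓝 (x₀, 0), dist q.1 x₀ < ρ :=
    (continuous_fst.dist continuous_const).continuousAt.eventually_lt_const (by simpa using hρ)
  have h2 : ∀ᶠ q : (Fin n → ℚ_[p]) × ℝ in 𝓝 (x₀, 0), q.2 < ρ ^ γ :=
    continuous_snd.continuousAt.eventually_lt_const (Real.rpow_pos_of_pos hρ γ)
  filter_upwards [h1, h2] with q hq1 hq2 hq0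
  obtain ⟨c, s, hc, hs1, hs2, hq⟩ := ha.exists_eq_mul_norm_rpow hq0
  have hs0 : 0 < s := one_pos.trans_le hs1
  have hcρ : ‖c‖ < ρ := by
    refine lt_of_not_ge fun hle => not_le.2 hq2 ?_
    rw [hq]
    calc ρ ^ γ ≤ ‖c‖ ^ γ := Real.rpow_le_rpow hρ.le hle hγ.le
      _ ≤ s * ‖c‖ ^ γ := le_mul_of_one_le_left (by positivity) hs1
  have hcn : (0 : ℝ) < ‖c‖ ^ n := by have := norm_pos_iff.2 hc; positivity
  have hZ := ha.integrable_fourierInv_expSymbol hs0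
  have hscale : ∫ η, fourierInv (expSymbol a q.2) η * φ (q.1 - η) =
      ∫ η, fourierInv (expSymbol a s) η * φ (q.1 - c • η) := by
    have h3 := integral_comp_smul hc (fun η => fourierInv (expSymbol a q.2) η * φ (q.1 - η))
    have h4 : ∀ η, fourierInv (expSymbol a q.2) (c • η) * φ (q.1 - c • η) =
        ((‖c‖ ^ n)⁻¹ : ℝ) • (fourierInv (expSymbol a s) η * φ (q.1 - c • η)) := by
      intro η
      rw [hq, ha.fourierInv_expSymbol_mul hc, smul_mul_assoc]
    simp_rw [h4] at h3
    rw [integral_smul] at h3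
    exact (smul_right_injective ℂ (inv_pos.2 hcn).ne' h3).symm
  have hone : ∫ η, fourierInv (expSymbol a s) η * φ x₀ = φ x₀ := by
    rw [integral_mul_const, ha.integral_fourierInv_expSymbol hs0, one_mul]
  have hint : Integrable fun η => fourierInv (expSymbol a s) η * φ (q.1 - c • η) :=
    hZ.mul_bdd (c := C) (Continuous.aestronglyMeasurable (by fun_prop)) (ae_of_all _ fun η => hC _)
  rw [dist_eq_norm, hscale]
  conv_lhs => rw [← hone]
  rw [← integral_sub hint (hZ.mul_const _)]
  refine lt_of_le_of_lt ?_ (hρ' (y := (q.1, c)) ?_)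
  · refine norm_integral_le_of_norm_le ?_ (ae_of_all _ fun η => ?_)
    · exact hM.mul_bdd (c := C + C) (hJint q.1 c).aestronglyMeasurable
        (ae_of_all _ fun η => by rw [norm_norm]; exact hJle _)
    · rw [← mul_sub, norm_mul]
      exact mul_le_mul_of_nonneg_right (hA s hs1 hs2 η) (norm_nonneg _)
  · rw [Prod.dist_eq]
    exact max_lt hq1 (by simpa using hcρ)

end IsHomogeneousSymbol

/-! ### Membership in `H̃_∞` -/

/-- The integral in `betaNorm` is a Bochner integral; under the hypothesis that its integrand is
integrable, `betaNorm` is a genuine `L²` norm. -/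
theorem betaNorm_eq_eLpNorm (w : Fin n → ℕ) (d : ℕ) (β : ℝ) {φ ψ : (Fin n → ℚ_[p]) → ℂ}
    (hφψ : fourier φ = ψ) (h : MemLp (fun ξ => ((bigXi w d ξ ^ β : ℝ) : ℂ) * ψ ξ) 2) :
    betaNorm w d β φ =
      (eLpNorm (fun ξ => ((bigXi w d ξ ^ β : ℝ) : ℂ) * ψ ξ) 2 volume).toReal := by
  have hXi : ∀ ξ : Fin n → ℚ_[p], 0 ≤ bigXi w d ξ := fun ξ =>
    Finset.sum_nonneg fun i _ => by positivity
  rw [MemLp.eLpNorm_eq_integral_rpow_norm two_ne_zero ENNReal.ofNat_ne_top h,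
    ENNReal.toReal_ofReal (by positivity), betaNorm, Real.sqrt_eq_rpow, hφψ]
  congr 1
  · congr 1; ext ξ
    rw [norm_mul, Complex.norm_real, Real.norm_of_nonneg (Real.rpow_nonneg (hXi ξ) β),
      ENNReal.toReal_ofNat, Real.rpow_ofNat, mul_pow, ← Real.rpow_natCast (bigXi w d ξ ^ β),
      ← Real.rpow_mul (hXi ξ), mul_comm β]
    norm_num
  · simp

theorem continuous_bigXi_rpow (w : Fin n → ℕ) (d : ℕ) {β : ℝ} (hβ : 0 ≤ β) :
    Continuous fun ξ : Fin n → ℚ_[p] => bigXi w d ξ ^ β := by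
  refine Continuous.rpow_const ?_ fun _ => Or.inr hβ
  unfold bigXi
  refine continuous_finsetSum _ fun i _ => ?_
  exact ((continuous_apply i).norm).rpow_const fun _ => Or.inr (by positivity)

theorem abs_bigXi_rpow_le (d : ℕ) {β : ℝ} (hβ : 0 ≤ β) (ξ : Fin n → ℚ_[p]) :
    |bigXi (fun _ => 1) d ξ ^ β| ≤ (n : ℝ) ^ β * (max 1 ‖ξ‖) ^ ((d : ℝ) * β) := by
  have hXi : 0 ≤ bigXi (fun _ => 1) d ξ := Finset.sum_nonneg fun i _ => by positivity
  have hle : bigXi (fun _ => 1) d ξ ≤ n * (max 1 ‖ξ‖) ^ (d : ℝ) := by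
    have : ∀ i ∈ Finset.univ, ‖ξ i‖ ^ ((d : ℝ) / ((1 : ℕ) : ℝ)) ≤ (max 1 ‖ξ‖) ^ (d : ℝ) := by
      intro i _
      rw [Nat.cast_one, div_one]
      exact Real.rpow_le_rpow (norm_nonneg _) ((norm_le_pi_norm ξ i).trans (le_max_right _ _))
        d.cast_nonneg
    simpa [bigXi] using Finset.sum_le_sum this
  rw [abs_of_nonneg (Real.rpow_nonneg hXi β), Real.rpow_mul (by positivity),
    ← Real.mul_rpow (by positivity) (by positivity)]
  exact Real.rpow_le_rpow hXi hle hβ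

/-- A function whose Fourier transform is the heat symbol times an `L²` function belongs to
`H̃_∞`: truncating near `0` gives Lizorkin functions, and `Ξ^β e^{-ta}` is bounded for every `β`. -/
theorem IsHomogeneousSymbol.memHInfty_fourierInv {a : (Fin n → ℚ_[p]) → ℝ} {γ : ℝ}
    (ha : IsHomogeneousSymbol a γ) (hn : n ≠ 0) (d : ℕ) {t : ℝ} (ht : 0 < t)
    {Φ : (Fin n → ℚ_[p]) → ℂ} (hΦ : MemLp Φ 2) :
    MemHInfty (fun _ => 1) d (fourierInv (expSymbol a t * Φ)) := by
  obtain ⟨χ, hχ, hχ0, hlim⟩ := exists_seq_isSchwartzBruhat_eventually_zero hn hΦ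
  obtain ⟨hF, hconv⟩ := isL2Fourier_fourierInv_mul (fun ξ => ha.eventually_expSymbol_eq t)
    (ha.norm_expSymbol_le_one ht.le) (ha.memLp_expSymbol ht) hΦ hχ hχ0 hlim
  have hS : ∀ k, IsSchwartzBruhat (expSymbol a t * χ k) := fun k =>
    (hχ k).mul_of_locallyConstant_off_zero (fun ξ => ha.eventually_expSymbol_eq t) (hχ0 k)
  refine ⟨hF.1, fun k => fourierInv (expSymbol a t * χ k), fun k => ⟨(hS k).fourierInv, ?_⟩,
    fun β ε hε => ?_, hconv⟩
  · rw [(hS k).fourier_fourierInv, Pi.mul_apply, (hχ0 k).self_of_nhds, Pi.zero_apply, mul_zero]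
  have hβ : (0 : ℝ) ≤ β := β.cast_nonneg
  obtain ⟨⟨B, hB⟩, hm⟩ := ha.exists_bound_mul_expSymbol ht
    (continuous_bigXi_rpow (p := p) (fun _ : Fin n => 1) d hβ) (abs_bigXi_rpow_le d hβ)
  set m : (Fin n → ℚ_[p]) → ℂ := fun ξ =>
    ((bigXi (fun _ => 1) d ξ ^ (β : ℝ) : ℝ) : ℂ) * expSymbol a t ξ with hmdef
  have hmχ : ∀ k, MemLp (m * χ k) 2 := fun k => memLp_mul_of_bdd hm.1 hB ((hχ k).memLp 2)
  have hmΦ : MemLp (m * Φ) 2 := memLp_mul_of_bdd hm.1 hB hΦ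
  have hnorm : ∀ k l, betaNorm (fun _ => 1) d (β : ℝ) (fourierInv (expSymbol a t * χ k) -
      fourierInv (expSymbol a t * χ l)) = (eLpNorm (m * χ k - m * χ l) 2 volume).toReal := by
    intro k l
    have h1 : fourier (fourierInv (expSymbol a t * χ k) - fourierInv (expSymbol a t * χ l)) =
        expSymbol a t * χ k - expSymbol a t * χ l := by
      rw [fourier_sub (hS k).fourierInv.integrable (hS l).fourierInv.integrable,
        (hS k).fourier_fourierInv, (hS l).fourier_fourierInv]
    have h2 : (fun ξ => ((bigXi (fun _ => 1) d ξ ^ (β : ℝ) : ℝ) : ℂ) *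
        (expSymbol a t * χ k - expSymbol a t * χ l) ξ) = m * χ k - m * χ l := by
      ext ξ
      simp only [hmdef, Pi.sub_apply, Pi.mul_apply]
      ring
    rw [betaNorm_eq_eLpNorm _ _ _ h1 (by rw [h2]; exact (hmχ k).sub (hmχ l)), h2]
  have hε2 : 0 < ENNReal.ofReal (ε / 2) := ENNReal.ofReal_pos.2 (half_pos hε)
  obtain ⟨N, hN⟩ := eventually_atTop.1 ((tendsto_eLpNorm_mul hB hlim).eventually_lt_const hε2)
  refine ⟨N, fun k hk l hl => ?_⟩
  rw [hnorm]
  refine (ENNReal.toReal_lt_of_lt_ofReal ?_)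
  calc eLpNorm (m * χ k - m * χ l) 2 volume
      = eLpNorm ((m * χ k - m * Φ) - (m * χ l - m * Φ)) 2 volume := by
        rw [sub_sub_sub_cancel_right]
    _ ≤ eLpNorm (m * χ k - m * Φ) 2 volume + eLpNorm (m * χ l - m * Φ) 2 volume :=
        eLpNorm_sub_le ((hmχ k).sub hmΦ).1 ((hmχ l).sub hmΦ).1 one_le_two
    _ < ENNReal.ofReal (ε / 2) + ENNReal.ofReal (ε / 2) := ENNReal.add_lt_add (hN k hk) (hN l hl)
    _ = ENNReal.ofReal ε := by
        rw [← ENNReal.ofReal_add (half_pos hε).le (half_pos hε).le, add_halves]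

end PadicPDE

open PadicPDE in
theorem mainTheorem6 {p : ℕ} [Fact p.Prime] {n : ℕ} (f : MvPolynomial (Fin n) ℚ_[p]) (d : ℕ)
    (hf : PadicPDE.IsElliptic f d) (α : ℝ) (hα : 0 < α) (φ : (Fin n → ℚ_[p]) → ℂ)
    (hφ_L2 : MemLp φ 2 volume) (hφ_cont : Continuous φ) (hφ_bdd : ∃ C : ℝ, ∀ x, ‖φ x‖ ≤ C) :
    (∀ t : ℝ, 0 < t →
      Integrable (PadicPDE.heatSymbol f α t) volume ∧
      ∀ x, Integrable (fun η => PadicPDE.heatKernel f α η t * φ (x - η)) volume) ∧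
    PadicPDE.IsClassicalSolution f α φ (PadicPDE.heatSolution f α φ) ∧
    ∀ t : ℝ, 0 < t →
      PadicPDE.MemHInfty (fun _ => 1) d (fun x => PadicPDE.heatSolution f α φ x t) := by
  have ha := hf.isHomogeneousSymbol hα
  set a : (Fin n → ℚ_[p]) → ℝ := symbol f α with hadef
  obtain ⟨C, hC⟩ := hφ_bdd
  obtain ⟨Φ, hF⟩ := exists_isL2Fourier hφ_L2
  have hΦ : MemLp Φ 2 := hF.2.1
  obtain ⟨χ, hχ, hχ0, hlim⟩ := exists_seq_isSchwartzBruhat_eventually_zero hf.dim_ne_zero hΦ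
  have hconv : ∀ t, 0 < t → ∀ x, heatSolution f α φ x t =
      ∫ η, fourierInv (expSymbol a t) η * φ (x - η) := fun t ht x => if_pos ht
  have hsol : ∀ t, 0 < t → ∀ x, heatSolution f α φ x t = fourierInv (expSymbol a t * Φ) x :=
    fun t ht x => (hconv t ht x).trans (ha.integral_fourierInv_expSymbol_mul_comp_sub ht hF x)
  have hzero : ∀ x, heatSolution f α φ x 0 = φ x := fun x => if_neg (lt_irrefl _)
  obtain ⟨Ca, hCa⟩ := ha.abs_le
  have hb1 : ∀ t, 0 < t → MemLp (fun ξ => ((1 : ℝ) : ℂ) * expSymbol a t ξ) 2 := fun t ht => by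
    simpa using ha.memLp_expSymbol ht
  have hba : ∀ t, 0 < t → (∃ B : ℝ, ∀ ξ, ‖(a ξ : ℂ) * expSymbol a t ξ‖ ≤ B) ∧
      MemLp (fun ξ => (a ξ : ℂ) * expSymbol a t ξ) 2 := fun t ht =>
    ha.exists_bound_mul_expSymbol ht ha.continuous hCa
  refine ⟨fun t ht => ⟨ha.integrable_expSymbol ht, fun x => ?_⟩, ⟨?_, hzero, ?_⟩, fun t ht => ?_⟩
  · exact (ha.integrable_fourierInv_expSymbol ht).mul_bdd (c := C)
      (Continuous.aestronglyMeasurable (by fun_prop)) (ae_of_all _ fun η => hC _)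
  · rintro ⟨x₀, t₀⟩ (ht₀ : 0 ≤ t₀)
    rcases ht₀.eq_or_lt with rfl | ht₀
    · rw [ContinuousWithinAt, Metric.tendsto_nhds]
      intro ε hε
      have h1 := ha.tendsto_integral_fourierInv_expSymbol_mul hφ_cont hC x₀ hε
      have h2 : ∀ᶠ q : (Fin n → ℚ_[p]) × ℝ in 𝓝 (x₀, 0), dist (φ q.1) (φ x₀) < ε :=
        ((hφ_cont.comp continuous_fst).dist continuous_const).continuousAt.eventually_lt_const
          (by simpa using hε)
      filter_upwards [nhdsWithin_le_nhds h1, nhdsWithin_le_nhds h2, self_mem_nhdsWithin]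
        with q hq1 hq2 (hq3 : 0 ≤ q.2)
      simp only [hzero]
      rcases hq3.eq_or_lt with hq | hq
      · rwa [← hq, hzero]
      · rw [hconv _ hq]; exact hq1 hq
    · have h1 := ha.continuousOn_fourierInv_mul_expSymbol (b := fun _ => 1) hb1 hΦ
      have hopen : IsOpen {q : (Fin n → ℚ_[p]) × ℝ | 0 < q.2} :=
        isOpen_lt continuous_const continuous_snd
      have h2 := h1.continuousAt (hopen.mem_nhds (x := (x₀, t₀)) ht₀)
      refine (h2.congr ?_).continuousWithinAt
      filter_upwards [hopen.mem_nhds (x := (x₀, t₀)) ht₀] with q hq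
      rw [hsol _ hq]
      congr 2
      ext ξ
      simp
  · refine ⟨fun x t => fourierInv ((fun ξ => (a ξ : ℂ) * expSymbol a t ξ) * Φ) x,
      ha.continuousOn_fourierInv_mul_expSymbol (fun t ht => (hba t ht).2) hΦ,
      fun t ht => ⟨⟨expSymbol a t * Φ, ?_, ?_⟩, fun x => ?_⟩⟩
    · rw [funext (hsol t ht)]
      exact (isL2Fourier_fourierInv_mul (fun ξ => ha.eventually_expSymbol_eq t)
        (ha.norm_expSymbol_le_one ht.le) (ha.memLp_expSymbol ht) hΦ hχ hχ0 hlim).1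
    · obtain ⟨⟨B, hB⟩, hm⟩ := hba t ht
      have h := (isL2Fourier_fourierInv_mul (fun ξ hξ => ?_) hB hm hΦ hχ hχ0 hlim).1
      · convert h using 2 with ξ
        simp only [Pi.mul_apply, hadef]; ring
      · filter_upwards [ha.eventually_eq hξ, ha.eventually_expSymbol_eq t hξ] with η h1 h2
        rw [h1, h2]
    · refine (ha.hasDerivAt_fourierInv_expSymbol_mul hΦ (fun t ht => (hba t ht).2) ht
        x).congr_of_eventuallyEq ?_
      filter_upwards [Ioi_mem_nhds ht] with s hs
      exact hsol s hs x
  · rw [funext (hsol t ht)]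
    exact ha.memHInfty_fourierInv hf.dim_ne_zero d ht hΦ
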